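/- Let $(C,J)$ be a site with finite products, regarded as a category $F_1$, and let $X=(X_i)_{i\in I}$ be a family of objects covering the final object; write $X_{i_0\dots i_k}=X_{i_0}\times\dots\times X_{i_k}$. Let $F_n\to F_{n-1}\to\dots\to F_2\to F_1$ be an abelian tower of torsors over $F_1$ with strict restriction functors between the fibres $F_i(U)$, $U\in C$. This means the following. $F_2\to F_1$ is a gerbe with band an abelian sheaf $L_2$. For $1\le i<n$, arrows of $F_{i+1}(U)$ projecting to an identity of $F_i(U)$ are invertible, and there is an abelian sheaf $L_{i+1}$ on $F_1$ with isomorphisms $L_{i+1}(U)\cong \mathrm{Aut}_{x_i}(x_{i+1})$, compatible with restriction and natural in the fibre over $x_i$, for every $x_{i+1}\in F_{i+1}(U)$ over $x_i\in F_i(U)$. Arrows of $F_i(U)$ projecting to an identity of $F_{i-1}(U)$ have cartesian lifts to $F_{i+1}(U)$ ($2\le i<n$). For $2\le i<n$ there is an abelian sheaf $L'_{i+1}$ on $F_1$ (the sheaf of fibre automorphisms) with isomorphisms, compatible with restriction, of $L'_{i+1}(U)$ with the group $\mathrm{Aut}_{x_{i-1}}(x_{i+1})$ of automorphisms of $x_{i+1}\in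 F_{i+1}(U)$ which project to the identity of $x_{i-1}$, but not necessarily to that of $x_i$. The $F_i$ are locally non-empty, and any two objects of $F_{i+1}(U)$ are locally isomorphic, by isomorphisms which project to the identity at every level where the projections of the two objects coincide and which commute with the actions of $L_{i+1}$, of $L'_{i+1}$, and (on the projections to $F_i$) of $L_i$; the last two only for $i\ge 2$. Classifying cocycles $c_l$ (Čech $l$-cochains of $L_l$ relative to $X$, $2\le l\le n$) are constructed as follows. Choose $x_i\in F_2(X_i)$ and $g_{ij}:x_j|_{X_{ij}}\to x_i|_{X_{ij}}$, and let $c_2$ be the cochain $c_{i_0i_1i_2}=g_{i_0i_2}^{-1}g_{i_0i_1}g_{i_1i_2}$, an automorphism of $x_{i_2}|_{X_{i_0i_1i_2}}$. Given $c_l$ with $2\le l<n$, choose objects $x_{i_0\dots i_{l+1}}\in F_{l+1}(X_{i_0\dots i_{l+1}})$ and sections $c^*_{i_0\dots i_l}\in L'_{l+1}(X_{i_0\dots i_l})$ whose restrictions act on the $x_{i_0\dots i_{l+1}}$ as lifts of the automorphisms, given by $c_{i_0\dots i_l}$, of the projections of these objects to $F_l$; then $c_{l+1}$ is the cochain of $L_{l+1}$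 whose action on $x_{i_0\dots i_{l+1}}$ is $\sum_j(-1)^j c^*_{i_0\dots\hat{i_j}\dots i_{l+1}}$. Then, for $2\le l<n$ and for every such system of choices: the inclusions $\mathrm{Aut}_{x_l}(x_{l+1})\subseteq\mathrm{Aut}_{x_{l-1}}(x_{l+1})$ and the projections $\mathrm{Aut}_{x_{l-1}}(x_{l+1})\to\mathrm{Aut}_{x_{l-1}}(x_l)$ define unique morphisms of sheaves $\alpha:L_{l+1}\to L'_{l+1}$ and $\beta:L'_{l+1}\to L_l$; the sequence $$0\to L_{l+1}\xrightarrow{\alpha}L'_{l+1}\xrightarrow{\beta}L_l\to 0$$ is exact; $c_l$ and $c_{l+1}$ are Čech cocycles; there is a Čech cochain $b$ of $L'_{l+1}$ with $\beta(b)=c_l$ and $\alpha(c_{l+1})=db$; and in sheaf cohomology $[c_{l+1}]=\delta[c_l]$, where $\delta:H^l(F_1,L_l)\to H^{l+1}(F_1,L_{l+1})$ is the connecting homomorphism of the sequence (the "Dolbeault operator"). -/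

import Mathlib

open CategoryTheory CategoryTheory.Limits Opposite

universe v u v₁ u₁

namespace TorsorTowers

noncomputable section

/-! ### Abelian sheaves, Čech cochains and sheaf cohomology -/

/-- The category of abelian sheaves on a site is a Grothendieck abelian category; in particular
it has enough injectives and its `Ext` groups are available. -/
instance isGrothendieckAbelian_sheaf {C : Type u} [Category.{v} C] (J : GrothendieckTopology C) :
    IsGrothendieckAbelian.{max u v} (Sheaf J AddCommGrpCat.{max u v}) := by
  have : EssentiallySmall.{max u v} C := inferInstance
  exact Sheaf.isGrothendieckAbelian_of_essentiallySmall J _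

/-- The sections of an abelian sheaf over an object. -/
abbrev Sec {C : Type u} [Category.{v} C] {J : GrothendieckTopology C}
    (A : Sheaf J AddCommGrpCat.{max u v}) (U : C) : Type (max u v) :=
  A.obj.obj (op U)

/-- Restriction of sections along `f : V ⟶ U`. -/
def resSec {C : Type u} [Category.{v} C] {J : GrothendieckTopology C}
    (A : Sheaf J AddCommGrpCat.{max u v}) {V U : C} (f : V ⟶ U) : Sec A U →+ Sec A V :=
  (A.obj.map f.op).hom

/-- The action of a morphism of sheaves on sections. -/
def mapSec {C : Type u} [Category.{v} C] {J : GrothendieckTopology C}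
    {A B : Sheaf J AddCommGrpCat.{max u v}} (α : A ⟶ B) (U : C) : Sec A U →+ Sec B U :=
  (α.hom.app (op U)).hom

section Cech

variable {C : Type u} [Category.{v} C] [HasFiniteProducts C] {J : GrothendieckTopology C}
  {ι : Type (max u v)} (X : ι → C)

/-- `X_{s₀ … s_{k-1}}`, the fibre product of the `X_{s a}` over the final object, that is, their
product. -/
def cechObj {k : ℕ} (s : Fin k → ι) : C := ∏ᶜ fun a => X (s a)

/-- The projection `X_{s₀ … s_{k-1}} ⟶ X_{s a}`. -/
def vertex {k : ℕ} (s : Fin k → ι) (a : Fin k) : cechObj X s ⟶ X (s a) :=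
  Pi.π (fun a => X (s a)) a

/-- The projection which forgets the index in position `j`. -/
def face {k : ℕ} (t : Fin (k + 1) → ι) (j : Fin (k + 1)) :
    cechObj X t ⟶ cechObj X (t ∘ j.succAbove) :=
  Pi.lift fun a => vertex X t (j.succAbove a)

/-- Čech cochains of degree `k` relative to the family `X`. -/
abbrev Cochain (A : Sheaf J AddCommGrpCat.{max u v}) (k : ℕ) : Type (max u v) :=
  ∀ s : Fin (k + 1) → ι, Sec A (cechObj X s)

variable {X}

/-- The Čech differential. -/
def cechD {A : Sheaf J AddCommGrpCat.{max u v}} {k : ℕ} (c : Cochain X A k) :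
    Cochain X A (k + 1) :=
  fun t => ∑ j : Fin (k + 2), (-1 : ℤ) ^ (j : ℕ) • resSec A (face X t j) (c (t ∘ j.succAbove))

/-- The action of a morphism of sheaves on Čech cochains. -/
def mapCochain {A B : Sheaf J AddCommGrpCat.{max u v}} (α : A ⟶ B) {k : ℕ} (c : Cochain X A k) :
    Cochain X B k :=
  fun s => mapSec α _ (c s)

end Cech

section Cohomology

variable {C : Type u} [Category.{v} C] {J : GrothendieckTopology C}

/-- The connecting homomorphism `H^k(C, Z) → H^{k+1}(C, X)` of the long exact cohomology sequence
of a short exact sequence `0 → X → Y → Z → 0` of abelian sheaves. -/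
def connecting {S : ShortComplex (Sheaf J AddCommGrpCat.{max u v})} (hS : S.ShortExact) (k : ℕ)
    (x : S.X₃.H k) : S.X₁.H (k + 1) :=
  x.comp hS.extClass rfl

/-- An embedding of an abelian sheaf into an injective one, with its cokernel. -/
def injectiveSequence (A : Sheaf J AddCommGrpCat.{max u v}) :
    ShortComplex (Sheaf J AddCommGrpCat.{max u v}) :=
  ShortComplex.mk (Injective.ι A) (cokernel.π (Injective.ι A)) (cokernel.condition _)

theorem injectiveSequence_shortExact (A : Sheaf J AddCommGrpCat.{max u v}) :
    (injectiveSequence A).ShortExact where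
  exact := ShortComplex.exact_cokernel _
  mono_f := inferInstanceAs (Mono (Injective.ι A))
  epi_g := inferInstanceAs (Epi (cokernel.π (Injective.ι A)))

open Classical in
/-- The canonical map from Čech cocycles relative to a family covering the final object to sheaf
cohomology, i.e. the one which in degree `0` glues a compatible family of sections to a global
section, and which commutes with connecting homomorphisms. In degree `k + 1` it is computed by
dimension shifting: if `0 → A → I → Q → 0` is the chosen sequence with `I` injective, a
`(k + 1)`-cocycle `c` of `A` becomes the coboundary of a cochain `b` of `I`, the image of `b` in
`Q` is a `k`-cocycle, and the class of `c` is the image of the class of the latter under the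
connecting homomorphism. (Cochains which are not cocycles get the value `0`.) -/
def cechClass [HasFiniteProducts C] {ι : Type (max u v)} (X : ι → C) :
    ∀ (k : ℕ) (A : Sheaf J AddCommGrpCat.{max u v}), Cochain X A k → A.H k
  | 0, A, c =>
    if h : ∃ a : Sec A (⊤_ C), ∀ s, resSec A (terminal.from (cechObj X s)) a = c s then
      (Sheaf.H.equiv₀ A terminalIsTerminal).symm h.choose
    else 0
  | k + 1, A, c =>
    if h : ∃ b : Cochain X (injectiveSequence A).X₂ k,
        cechD b = mapCochain (injectiveSequence A).f c then
      connecting (injectiveSequence_shortExact A) k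
        (cechClass X k (injectiveSequence A).X₃ (mapCochain (injectiveSequence A).g h.choose))
    else 0

end Cohomology

/-! ### Gerbes and towers of torsors -/

section Tower

variable {C : Type u} [Category.{v} C]

/-- The restriction functor along `f : V ⟶ U` of a strict presheaf of categories. -/
def res (G : Cᵒᵖ ⥤ Cat.{v₁, u₁}) {V U : C} (f : V ⟶ U) : G.obj (op U) ⥤ G.obj (op V) :=
  (G.map f.op).toFunctor

theorem res_comp_obj (G : Cᵒᵖ ⥤ Cat.{v₁, u₁}) {W V U : C} (f : W ⟶ V) (g : V ⟶ U)
    (x : G.obj (op U)) : (res G (f ≫ g)).obj x = (res G f).obj ((res G g).obj x) := by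
  simp [res]

/-- Gerbes, given with strict restriction functors: stacks in groupoids which are locally
non-empty and in which any two objects are locally isomorphic. -/
structure IsGerbe (J : GrothendieckTopology C) (G : Cᵒᵖ ⥤ Cat.{v₁, u₁}) : Prop where
  stack : (Functor.toPseudofunctor' G).IsStack J
  isIso : ∀ {U : C} {x y : G.obj (op U)} (f : x ⟶ y), IsIso f
  locally_nonempty : ∀ U : C, ∃ S ∈ J U, ∀ ⦃V : C⦄ (f : V ⟶ U), S f → Nonempty (G.obj (op V))
  locally_isomorphic : ∀ {U : C} (x y : G.obj (op U)),
    ∃ S ∈ J U, ∀ ⦃V : C⦄ (f : V ⟶ U), S f → Nonempty ((res G f).obj x ≅ (res G f).obj y)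

/-- The data of a tower `F_n → F_{n-1} → … → F_2 → F_1` over the site `F_1 = (C, J)`. The category
`F_i` is given by its fibres `F_i(U)` over the objects `U` of `C` with their strict restriction
functors, and `p i : F_{i+1} → F_i` commutes with the restrictions. The sheaf `L i` acts on the
objects of `F_i`, and so does `L' i`. Only the levels `1 ≤ i ≤ n` are meaningful: see
`TowerData.IsTorsorTower`. -/
structure TowerData (J : GrothendieckTopology C) where
  F : ℕ → Cᵒᵖ ⥤ Cat.{v₁, u₁}
  p : ∀ i, F (i + 1) ⟶ F i
  L : ℕ → Sheaf J AddCommGrpCat.{max u v}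
  L' : ℕ → Sheaf J AddCommGrpCat.{max u v}
  act : ∀ (i : ℕ) {U : C} (x : (F i).obj (op U)), Multiplicative (Sec (L i) U) →* Aut x
  act' : ∀ (i : ℕ) {U : C} (x : (F i).obj (op U)), Multiplicative (Sec (L' i) U) →* Aut x

namespace TowerData

variable {J : GrothendieckTopology C} (T : TowerData.{v, u, v₁, u₁} J)

/-- The functor `F_{i+1}(U) ⥤ F_i(U)` induced by `p_{i+1} : F_{i+1} → F_i`. -/
def pr (i : ℕ) (U : C) : (T.F (i + 1)).obj (op U) ⥤ (T.F i).obj (op U) :=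
  ((T.p i).app (op U)).toFunctor

/-- The automorphism of `x` given by a section of `L i`. -/
def aut (i : ℕ) {U : C} (x : (T.F i).obj (op U)) (s : Sec (T.L i) U) : x ≅ x :=
  T.act i x (Multiplicative.ofAdd s)

/-- The automorphism of `x` given by a section of `L' i`. -/
def aut' (i : ℕ) {U : C} (x : (T.F i).obj (op U)) (s : Sec (T.L' i) U) : x ≅ x :=
  T.act' i x (Multiplicative.ofAdd s)

/-- `u : x ⟶ y` projects to the identity in every `F_c`, `1 ≤ c < m`, in which `x` and `y` have
the same projection. -/
def ProjectsToId : ∀ (m : ℕ) {U : C} {x y : (T.F m).obj (op U)}, (x ⟶ y) → Prop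
  | 0, _, _, _, _ => True
  | 1, _, _, _, _ => True
  | m + 2, U, x, y, u =>
    ((T.pr (m + 1) U).obj x = (T.pr (m + 1) U).obj y →
      (T.pr (m + 1) U).IsHomLift (𝟙 ((T.pr (m + 1) U).obj x)) u) ∧
    ProjectsToId (m + 1) ((T.pr (m + 1) U).map u)

/-- The isomorphism `u` commutes with the action of `L i`. -/
def Commutes (i : ℕ) {U : C} {x y : (T.F i).obj (op U)} (u : x ≅ y) : Prop :=
  ∀ s : Sec (T.L i) U, (T.aut i x s).hom ≫ u.hom = u.hom ≫ (T.aut i y s).hom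

/-- The isomorphism `u` commutes with the action of `L' i`. -/
def Commutes' (i : ℕ) {U : C} {x y : (T.F i).obj (op U)} (u : x ≅ y) : Prop :=
  ∀ s : Sec (T.L' i) U, (T.aut' i x s).hom ≫ u.hom = u.hom ≫ (T.aut' i y s).hom

/-- The tower `F_n → … → F_1` is an abelian tower of torsors with sheaves `L_2, …, L_n`, and
`L'_3, …, L'_n` are its sheaves of automorphisms of the fibres `(F_{i+2})_{x_i}`. An arrow `f` of a
fibre is said to project to the identity if it is a lift of an identity arrow. -/
structure IsTorsorTower (n : ℕ) : Prop where
  /-- The fibre of `F_1` over `U` has `U` as its only object and `id_U` as its only arrow. -/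
  base_obj : ∀ U : C, Nonempty (Unique ((T.F 1).obj (op U)))
  base_hom : ∀ (U : C) (x y : (T.F 1).obj (op U)), Subsingleton (x ⟶ y)
  /-- `F_2 → F_1` is a gerbe; its band is `L_2` by `aut_injective`, `aut_range`, `aut_res` and
  `aut_natural` for `i = 1`. -/
  gerbe : 2 ≤ n → IsGerbe J (T.F 2)
  /-- Arrows of `F_{i+1}` which project to an identity of `F_i` are invertible. -/
  isIso_of_isHomLift_id : ∀ i, 1 ≤ i → i < n → ∀ {U : C} {x y : (T.F (i + 1)).obj (op U)}
    (f : x ⟶ y), (T.pr i U).IsHomLift (𝟙 ((T.pr i U).obj x)) f → IsIso f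
  /-- For `x_{i+1}` in `(F_{i+1})_{x_i}` the action is an isomorphism
  `L_{i+1}(U) ≅ Aut_{x_i}(x_{i+1})`. -/
  aut_injective : ∀ i, 1 ≤ i → i < n → ∀ {U : C} (x : (T.F (i + 1)).obj (op U)),
    Function.Injective (T.aut (i + 1) x)
  aut_range : ∀ i, 1 ≤ i → i < n → ∀ {U : C} (x : (T.F (i + 1)).obj (op U)) (φ : x ≅ x),
    (∃ s, T.aut (i + 1) x s = φ) ↔ (T.pr i U).mapIso φ = Iso.refl _
  /-- The isomorphisms are compatible with restrictions... -/
  aut_res : ∀ i, 1 ≤ i → i < n → ∀ {V U : C} (f : V ⟶ U) (x : (T.F (i + 1)).obj (op U))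
    (s : Sec (T.L (i + 1)) U), (res (T.F (i + 1)) f).mapIso (T.aut (i + 1) x s) =
      T.aut (i + 1) ((res (T.F (i + 1)) f).obj x) (resSec (T.L (i + 1)) f s)
  /-- ... and natural: a section of `L_{i+1}` acts as an automorphism of the fibre
  `(F_{i+1})_{x_i}`. -/
  aut_natural : ∀ i, 1 ≤ i → i < n → ∀ {U : C} {x y : (T.F (i + 1)).obj (op U)} (f : x ⟶ y),
    (T.pr i U).IsHomLift (𝟙 ((T.pr i U).obj x)) f → ∀ s : Sec (T.L (i + 1)) U,
      (T.aut (i + 1) x s).hom ≫ f = f ≫ (T.aut (i + 1) y s).hom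
  /-- An arrow of `F_i` which projects to an identity has cartesian lifts to `F_{i+1}`
  (`i = j + 1`). -/
  cartesian_lift : ∀ j, 1 ≤ j → j + 1 < n → ∀ {U : C} {x y : (T.F (j + 1)).obj (op U)} (a : x ⟶ y),
    (T.pr j U).IsHomLift (𝟙 ((T.pr j U).obj x)) a →
    ∀ y' : (T.F (j + 2)).obj (op U), (T.pr (j + 1) U).obj y' = y →
      ∃ (x' : (T.F (j + 2)).obj (op U)) (a' : x' ⟶ y'), (T.pr (j + 1) U).IsCartesian a a'
  /-- Any two objects of `F_{i+1}` over `U` are locally isomorphic, by isomorphisms which project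
  to the identity wherever this makes sense, and which commute with the action of `L_{i+1}` and,
  if `i ≥ 2`, with the actions of `L'_{i+1}` on `F_{i+1}` and of `L_i` on the projections
  to `F_i`. -/
  locally_isomorphic : ∀ i, 1 ≤ i → i < n → ∀ {U : C} (x y : (T.F (i + 1)).obj (op U)),
    ∃ S ∈ J U, ∀ ⦃V : C⦄ (f : V ⟶ U), S f →
      ∃ u : (res (T.F (i + 1)) f).obj x ≅ (res (T.F (i + 1)) f).obj y,
        T.ProjectsToId (i + 1) u.hom ∧ T.Commutes (i + 1) u ∧
        (2 ≤ i → T.Commutes' (i + 1) u ∧ T.Commutes i ((T.pr i V).mapIso u))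
  /-- The tower is abelian: for `x_{i+2}` over `x_{i+1}` over `x_i` the group `Aut_{x_i}(x_{i+2})` of
  the automorphisms which project to the identity of `x_i`, but not necessarily to that of
  `x_{i+1}`, is the group of sections of the abelian sheaf `L'_{i+2}`. -/
  aut'_injective : ∀ i, 1 ≤ i → i + 1 < n → ∀ {U : C} (x : (T.F (i + 2)).obj (op U)),
    Function.Injective (T.aut' (i + 2) x)
  aut'_range : ∀ i, 1 ≤ i → i + 1 < n → ∀ {U : C} (x : (T.F (i + 2)).obj (op U)) (φ : x ≅ x),
    (∃ s, T.aut' (i + 2) x s = φ) ↔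
      (T.pr i U).mapIso ((T.pr (i + 1) U).mapIso φ) = Iso.refl _
  aut'_res : ∀ i, 1 ≤ i → i + 1 < n → ∀ {V U : C} (f : V ⟶ U) (x : (T.F (i + 2)).obj (op U))
    (s : Sec (T.L' (i + 2)) U), (res (T.F (i + 2)) f).mapIso (T.aut' (i + 2) x s) =
      T.aut' (i + 2) ((res (T.F (i + 2)) f).obj x) (resSec (T.L' (i + 2)) f s)
  /-- The fibres of `F_i` are locally non-empty. -/
  locally_nonempty : ∀ i, 1 ≤ i → i ≤ n → ∀ U : C,
    ∃ S ∈ J U, ∀ ⦃V : C⦄ (f : V ⟶ U), S f → Nonempty ((T.F i).obj (op V))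

/-- `α` is the morphism `L_{i+1} → L'_{i+1}` given by the inclusions
`Aut_{x_i}(x_{i+1}) ⊆ Aut_{x_{i-1}}(x_{i+1})`. -/
def IsInclusion (i : ℕ) (α : T.L (i + 1) ⟶ T.L' (i + 1)) : Prop :=
  ∀ {U : C} (x : (T.F (i + 1)).obj (op U)) (s : Sec (T.L (i + 1)) U),
    T.aut' (i + 1) x (mapSec α U s) = T.aut (i + 1) x s

/-- `β` is the morphism `L'_{i+1} → L_i` given by the projections
`Aut_{x_{i-1}}(x_{i+1}) → Aut_{x_{i-1}}(x_i)`. -/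
def IsProjection (i : ℕ) (β : T.L' (i + 1) ⟶ T.L i) : Prop :=
  ∀ {U : C} (x : (T.F (i + 1)).obj (op U)) (s : Sec (T.L' (i + 1)) U),
    T.aut i ((T.pr i U).obj x) (mapSec β U s) = (T.pr i U).mapIso (T.aut' (i + 1) x s)

/-! ### The classifying cocycles -/

section Cocycles

variable [HasFiniteProducts C] {ι : Type (max u v)} (X : ι → C)

/-- The restriction to `W`, along `a : W ⟶ X_i` and `b : W ⟶ X_j`, of an isomorphism
`g_{ij} : x_j|_{X_i × X_j} ≅ x_i|_{X_i × X_j}`. -/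
def pullIso (G : Cᵒᵖ ⥤ Cat.{v₁, u₁}) {Xi Xj W : C} {xi : G.obj (op Xi)} {xj : G.obj (op Xj)}
    (g : (res G (prod.snd : Xi ⨯ Xj ⟶ Xj)).obj xj ≅ (res G (prod.fst : Xi ⨯ Xj ⟶ Xi)).obj xi)
    (a : W ⟶ Xi) (b : W ⟶ Xj) : (res G b).obj xj ≅ (res G a).obj xi :=
  eqToIso (by rw [← res_comp_obj, prod.lift_snd]) ≪≫ (res G (prod.lift a b)).mapIso g ≪≫
    eqToIso (by rw [← res_comp_obj, prod.lift_fst])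

/-- `c` is a `2`-cochain `c_{i₀i₁i₂} = g_{i₀i₂}⁻¹ g_{i₀i₁} g_{i₁i₂}`, an automorphism of the restriction
of `x_{i₂}`, for objects `x_i` of `F_2` over `X_i` and arrows `g_{ij} : x_j → x_i` over
`X_i × X_j`. -/
def IsGerbeCocycle (c : Cochain X (T.L 2) 2) : Prop :=
  ∃ (x : ∀ i : ι, (T.F 2).obj (op (X i)))
    (g : ∀ i j : ι, (res (T.F 2) (prod.snd : X i ⨯ X j ⟶ X j)).obj (x j) ≅
      (res (T.F 2) (prod.fst : X i ⨯ X j ⟶ X i)).obj (x i)),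
    ∀ t : Fin 3 → ι,
      T.aut 2 ((res (T.F 2) (vertex X t 2)).obj (x (t 2))) (c t) =
        pullIso (T.F 2) (g (t 1) (t 2)) (vertex X t 1) (vertex X t 2) ≪≫
        pullIso (T.F 2) (g (t 0) (t 1)) (vertex X t 0) (vertex X t 1) ≪≫
        (pullIso (T.F 2) (g (t 0) (t 2)) (vertex X t 0) (vertex X t 2)).symm

/-- `c'` is an `(l + 1)`-cochain of `L_{l+1}` constructed from the `l`-cochain `c` of `L_l`: there are
objects `x_{i₀…i_{l+1}}` of `F_{l+1}` over `X_{i₀…i_{l+1}}`, and sections `c*_{i₀…i_l}` of `L'_{l+1}` whose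
restrictions, as automorphisms of these objects, are lifts of the automorphisms of the projections
of the objects to `F_l` given by the `c_{i₀…i_l}`, such that the automorphism of `x_{i₀…i_{l+1}}` given by
`c'_{i₀…i_{l+1}}` is the alternating sum of the lifts. -/
def IsNextCocycle (l : ℕ) (c : Cochain X (T.L l) l) (c' : Cochain X (T.L (l + 1)) (l + 1)) : Prop :=
  ∃ (x : ∀ t : Fin (l + 2) → ι, (T.F (l + 1)).obj (op (cechObj X t)))
    (cs : Cochain X (T.L' (l + 1)) l),
    (∀ (t : Fin (l + 2) → ι) (j : Fin (l + 2)),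
      (T.pr l _).mapIso (T.aut' (l + 1) (x t)
          (resSec (T.L' (l + 1)) (face X t j) (cs (t ∘ j.succAbove)))) =
        T.aut l ((T.pr l _).obj (x t)) (resSec (T.L l) (face X t j) (c (t ∘ j.succAbove)))) ∧
    ∀ t : Fin (l + 2) → ι, T.aut (l + 1) (x t) (c' t) = T.aut' (l + 1) (x t) (cechD cs t)

/-- `c_2, …, c_n` is a family of classifying cocycles of the tower, constructed successively by
means of the family `X`. -/
def IsClassifyingFamily (n : ℕ) (c : ∀ l, Cochain X (T.L l) l) : Prop :=
  T.IsGerbeCocycle X (c 2) ∧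
    ∀ l, 2 ≤ l → l < n → T.IsNextCocycle X l (c l) (c (l + 1))

end Cocycles

end TowerData

end Tower

end

end TorsorTowers

namespace TorsorTowers

/-! ### Sections of abelian sheaves -/

section Sections

variable {C : Type u} [Category.{v} C] {J : GrothendieckTopology C}
  {A B D : Sheaf J AddCommGrpCat.{max u v}}

/-! For an object `x` of `F_{l+1}`, the automorphisms over the identity of its image in `F_l` form
the kernel of the projection from the automorphisms over the identity of its image in `F_{l-1}` to
the automorphisms of that image in `F_l`. Local isomorphisms commuting with the actions show that
these maps do not depend on `x`, so they glue to `α` and `β` (`exists_hom_of_locally`). Injectivity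
and middle exactness can be read off on local objects. Surjectivity of `β` needs geometry: a
cartesian lift of an automorphism is an isomorphism `x' ≅ x`, and a local isomorphism of `x'` with
`x` over the identity turns it into an automorphism of `x` (`projection_locallySurjective_of_obj`).

The lifts `c*` are themselves the cochain `b`: `α c_{l+1} = d c*` by construction, and `β c* = c_l`
holds after restriction to faces, hence already before (`IsNextCocycle.exists_cochain`). So `d
c_{l+1} = 0` because `d² = 0` and `α` is injective; for `c_2` there is a direct computation.

The equality of classes is then the compatibility of Čech classes with connecting homomorphisms
(`cechClass_eq_connecting`). Since `cechClass` is defined by dimension shifting, this amounts to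
independence of the choices and naturality, proved by induction on the degree together with
additivity. The input is that Čech cocycles of positive degree of an injective sheaf are
coboundaries (`exists_cechD_eq_of_injective`). -/

theorem resSec_id {U : C} (s : Sec A U) : resSec A (𝟙 U) s = s := by
  simp [resSec]

theorem resSec_comp {W V U : C} (g : W ⟶ V) (f : V ⟶ U) (s : Sec A U) :
    resSec A (g ≫ f) s = resSec A g (resSec A f s) := by
  simp [resSec]

theorem mapSec_resSec (α : A ⟶ B) {V U : C} (f : V ⟶ U) (s : Sec A U) :
    mapSec α V (resSec A f s) = resSec B f (mapSec α U s) :=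
  congrArg (fun φ : A.obj.obj (op U) ⟶ B.obj.obj (op V) => φ.hom s) (α.hom.naturality f.op)

theorem mapSec_comp (α : A ⟶ B) (β : B ⟶ D) {U : C} (s : Sec A U) :
    mapSec (α ≫ β) U s = mapSec β U (mapSec α U s) := rfl

theorem mapSec_zero {U : C} (s : Sec A U) : mapSec (0 : A ⟶ B) U s = 0 := rfl

theorem hom_ext_mapSec {α β : A ⟶ B} (h : ∀ U s, mapSec α U s = mapSec β U s) : α = β := by
  ext U s
  exact h U.unop s

/-- The underlying sheaf of types. -/
theorem isSheaf_forget (A : Sheaf J AddCommGrpCat.{max u v}) :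
    Presieve.IsSheaf J (A.obj ⋙ forget AddCommGrpCat.{max u v}) :=
  (isSheaf_iff_isSheaf_of_type _ _).1 ((sheafCompose J (forget AddCommGrpCat)).obj A).2

theorem sec_ext {U : C} {S : Sieve U} (hS : S ∈ J U) {s t : Sec A U}
    (h : ∀ ⦃V : C⦄ (f : V ⟶ U), S f → resSec A f s = resSec A f t) : s = t :=
  ((isSheaf_forget A).isSeparated S hS).ext (t₁ := s) (t₂ := t) h

theorem exists_glue {U : C} {S : Sieve U} (hS : S ∈ J U)
    (s : ∀ ⦃V : C⦄ (f : V ⟶ U), S f → Sec A V)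
    (hs : ∀ ⦃W V : C⦄ (g : W ⟶ V) (f : V ⟶ U) (hf : S f) (hgf : S (g ≫ f)),
      resSec A g (s f hf) = s (g ≫ f) hgf) :
    ∃ t : Sec A U, ∀ ⦃V : C⦄ (f : V ⟶ U) (hf : S f), resSec A f t = s f hf := by
  let x : Presieve.FamilyOfElements (A.obj ⋙ forget AddCommGrpCat.{max u v}) S.arrows :=
    fun V f hf => s f hf
  have hx : x.Compatible := by
    rw [Presieve.compatible_iff_sieveCompatible]
    intro V W f g hf
    exact (hs g f hf _).symm
  exact ⟨(isSheaf_forget A S hS).amalgamate x hx,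
    fun V f hf => (isSheaf_forget A S hS).valid_glue hx f hf⟩

/-- A morphism of sheaves from its action on sections. -/
theorem exists_hom (φ : ∀ U : C, Sec A U →+ Sec B U)
    (hφ : ∀ ⦃V U : C⦄ (f : V ⟶ U) (s : Sec A U), φ V (resSec A f s) = resSec B f (φ U s)) :
    ∃ α : A ⟶ B, ∀ U s, mapSec α U s = φ U s :=
  ⟨⟨{ app := fun U => AddCommGrpCat.ofHom (φ U.unop)
      naturality := fun U V f => by
        ext s
        exact hφ f.unop s }⟩, fun _ _ => rfl⟩

/-- A morphism of sheaves can be defined by means of auxiliary objects which exist locally, if it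
does not depend on these locally. -/
theorem exists_hom_of_locally {E : C → Type*} (rE : ∀ {V U : C}, (V ⟶ U) → E U → E V)
    (hE : ∀ U : C, ∃ S ∈ J U, ∀ ⦃V : C⦄ (f : V ⟶ U), S f → Nonempty (E V))
    (h : ∀ {U : C}, E U → Sec A U →+ Sec B U)
    (hr : ∀ {V U : C} (f : V ⟶ U) (x : E U) (s : Sec A U),
      h (rE f x) (resSec A f s) = resSec B f (h x s))
    (hind : ∀ {U : C} (x y : E U), ∃ S ∈ J U, ∀ ⦃V : C⦄ (f : V ⟶ U), S f →
      h (rE f x) = h (rE f y)) :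
    ∃ α : A ⟶ B, ∀ (U : C) (x : E U) (s : Sec A U), mapSec α U s = h x s := by
  have hh : ∀ {U : C} (x y : E U) (s : Sec A U), h x s = h y s := by
    intro U x y s
    obtain ⟨S, hS, H⟩ := hind x y
    refine sec_ext hS fun V f hf => ?_
    rw [← hr, ← hr, H f hf]
  have key : ∀ (U : C) (s : Sec A U), ∃ t : Sec B U,
      ∀ ⦃V : C⦄ (f : V ⟶ U) (x : E V), resSec B f t = h x (resSec A f s) := by
    intro U s
    obtain ⟨S, hS, H⟩ := hE U
    obtain ⟨t, ht⟩ := exists_glue (A := B) hS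
      (fun V f hf => h (H f hf).some (resSec A f s)) (by
        intro W V g f hf hgf
        rw [← hr, ← resSec_comp]
        exact hh _ _ _)
    refine ⟨t, fun V f x => ?_⟩
    refine sec_ext (J.pullback_stable f hS) fun W g hg => ?_
    rw [← resSec_comp, ht (g ≫ f) hg, ← hr, resSec_comp]
    exact hh _ _ _
  choose t ht using key
  -- The glued section is characterised by its restrictions to all `V` carrying an object;
  -- additivity and naturality both follow from this uniqueness.
  have huniq : ∀ (U : C) (s : Sec A U) (t' : Sec B U),
      (∀ ⦃V : C⦄ (f : V ⟶ U) (x : E V), resSec B f t' = h x (resSec A f s)) → t U s = t' := by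
    intro U s t' ht'
    obtain ⟨S, hS, H⟩ := hE U
    refine sec_ext hS fun V f hf => ?_
    rw [ht U s f (H f hf).some, ht' f (H f hf).some]
  obtain ⟨α, hα⟩ := exists_hom (A := A) (B := B)
    (fun U => AddMonoidHom.mk' (t U) fun a b => huniq _ _ _ fun V f x => by
      rw [map_add, map_add, map_add, ht U a f x, ht U b f x])
    (fun V U f s => huniq _ _ _ fun W g x => by
      rw [← resSec_comp, ← resSec_comp]
      exact ht U s (g ≫ f) x)
  refine ⟨α, fun U x s => ?_⟩
  rw [hα]
  have := ht U s (𝟙 U) x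
  rw [resSec_id, resSec_id] at this
  exact this

end Sections

/-! ### Čech cochains -/

section Cech

variable {C : Type u} [Category.{v} C] [HasFiniteProducts C] {J : GrothendieckTopology C}
  {ι : Type (max u v)} {X : ι → C} {A B : Sheaf J AddCommGrpCat.{max u v}}

theorem cechObj_hom_ext {W : C} {k : ℕ} {s : Fin k → ι} {f g : W ⟶ cechObj X s}
    (h : ∀ a, f ≫ vertex X s a = g ≫ vertex X s a) : f = g :=
  Limits.Pi.hom_ext _ _ h

theorem face_vertex {k : ℕ} (t : Fin (k + 1) → ι) (j : Fin (k + 1)) (a : Fin k) :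
    face X t j ≫ vertex X (t ∘ j.succAbove) a = vertex X t (j.succAbove a) :=
  Limits.Pi.lift_π _ _

theorem face_vertex_assoc {k : ℕ} (t : Fin (k + 1) → ι) (j : Fin (k + 1)) (a : Fin k) {Z : C}
    (h : X ((t ∘ j.succAbove) a) ⟶ Z) :
    face X t j ≫ vertex X (t ∘ j.succAbove) a ≫ h = vertex X t (j.succAbove a) ≫ h := by
  rw [← Category.assoc, face_vertex]

/-- Restrictions of a cochain depend only on the projections to the objects of the family. -/
theorem resSec_congr {W : C} {k : ℕ} (c : Cochain X A k) {s s' : Fin (k + 1) → ι} (h : s = s')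
    (f : W ⟶ cechObj X s) (f' : W ⟶ cechObj X s')
    (hf : ∀ a, (f ≫ vertex X s a) ≫ eqToHom (by rw [h]) = f' ≫ vertex X s' a) :
    resSec A f (c s) = resSec A f' (c s') := by
  subst h
  have : f = f' := cechObj_hom_ext fun a => by simpa using hf a
  rw [this]

theorem vertex_congr {k : ℕ} (t : Fin k → ι) {a b : Fin k} (h : a = b) :
    vertex X t a ≫ eqToHom (by rw [h]) = vertex X t b := by
  subst h; simp

theorem face_face_vertex {k : ℕ} (t : Fin (k + 2) → ι) (i : Fin (k + 2)) (j : Fin (k + 1))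
    (a : Fin k) : (face X t i ≫ face X (t ∘ i.succAbove) j) ≫
      vertex X ((t ∘ i.succAbove) ∘ j.succAbove) a = vertex X t (i.succAbove (j.succAbove a)) := by
  rw [Category.assoc, face_vertex]
  exact face_vertex _ _ _

theorem resSec_cechD {W : C} {k : ℕ} (c : Cochain X A k) (t : Fin (k + 2) → ι)
    (f : W ⟶ cechObj X t) :
    resSec A f (cechD c t) = ∑ j : Fin (k + 2),
      (-1 : ℤ) ^ (j : ℕ) • resSec A (f ≫ face X t j) (c (t ∘ j.succAbove)) := by
  simp only [cechD, map_sum, map_zsmul, resSec_comp]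

/-- Deleting the same two indices in the opposite order is a fixed-point-free involution of the
terms which reverses the sign. -/
theorem cechD_cechD {k : ℕ} (c : Cochain X A k) : cechD (cechD c) = 0 := by
  funext t
  have h : cechD (cechD c) t = ∑ p : Fin (k + 3) × Fin (k + 2), (-1 : ℤ) ^ (p.1 + p.2 : ℕ) •
      resSec A (face X t p.1 ≫ face X (t ∘ p.1.succAbove) p.2)
        (c ((t ∘ p.1.succAbove) ∘ p.2.succAbove)) := by
    rw [cechD, Fintype.sum_prod_type]
    refine Finset.sum_congr rfl fun i _ => ?_
    rw [resSec_cechD, Finset.smul_sum]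
    exact Finset.sum_congr rfl fun j _ => by rw [smul_smul, pow_add]
  rw [h]
  refine Finset.sum_involution (fun p _ => (p.1.succAbove p.2, p.2.predAbove p.1)) ?_ ?_
    (fun _ _ => Finset.mem_univ _) ?_
  · rintro ⟨i, j⟩ -
    have e : ∀ a, i.succAbove (j.succAbove a) =
        (i.succAbove j).succAbove ((j.predAbove i).succAbove a) := fun a =>
      (Fin.succAbove_succAbove_succAbove_predAbove i j a).symm
    have : resSec A (face X t i ≫ face X (t ∘ i.succAbove) j)
          (c ((t ∘ i.succAbove) ∘ j.succAbove)) =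
        resSec A (face X t (i.succAbove j) ≫ face X (t ∘ (i.succAbove j).succAbove)
          (j.predAbove i)) (c ((t ∘ (i.succAbove j).succAbove) ∘ (j.predAbove i).succAbove)) := by
      refine resSec_congr c (funext fun a => congrArg t (e a)) _ _ fun a => ?_
      refine (congrArg (· ≫ eqToHom _) (face_face_vertex t i j a)).trans ?_
      exact (vertex_congr t (e a)).trans (face_face_vertex t _ _ a).symm
    dsimp only
    rw [this, ← add_smul, Fin.neg_one_pow_succAbove_add_predAbove, add_neg_cancel, zero_smul]
  · rintro ⟨i, j⟩ - - h
    exact Fin.succAbove_ne _ _ (congrArg Prod.fst h)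
  · rintro ⟨i, j⟩ -
    exact Prod.ext (Fin.succAbove_succAbove_predAbove i j) (Fin.predAbove_predAbove_succAbove i j)

theorem mapCochain_cechD (α : A ⟶ B) {k : ℕ} (c : Cochain X A k) :
    mapCochain α (cechD c) = cechD (mapCochain α c) := by
  funext t
  simp only [mapCochain, cechD, map_sum, map_zsmul, mapSec_resSec]

theorem mapCochain_comp {D : Sheaf J AddCommGrpCat.{max u v}} (α : A ⟶ B) (β : B ⟶ D) {k : ℕ}
    (c : Cochain X A k) : mapCochain (α ≫ β) c = mapCochain β (mapCochain α c) := rfl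

theorem mapCochain_add (α : A ⟶ B) {k : ℕ} (c c' : Cochain X A k) :
    mapCochain α (c + c') = mapCochain α c + mapCochain α c' :=
  funext fun _ => map_add _ _ _

theorem mapCochain_of_zero (α : A ⟶ B) {k : ℕ} : mapCochain α (0 : Cochain X A k) = 0 :=
  funext fun _ => map_zero _

theorem zero_mapCochain {k : ℕ} (c : Cochain X A k) : mapCochain (0 : A ⟶ B) c = 0 := rfl

theorem cechD_add {k : ℕ} (c c' : Cochain X A k) : cechD (c + c') = cechD c + cechD c' := by
  funext t
  simp [cechD, Finset.sum_add_distrib]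

theorem cechD_sub {k : ℕ} (c c' : Cochain X A k) : cechD (c - c') = cechD c - cechD c' := by
  funext t
  simp [cechD, smul_sub, Finset.sum_sub_distrib]

end Cech

/-! ### Čech acyclicity of injective sheaves -/

section CechInjective

variable {C : Type u} [Category.{v} C] [HasFiniteProducts C] {J : GrothendieckTopology C}
  {ι : Type (max u v)} {X : ι → C}

/-- The presheaf `U ↦ ∏ i, P (X i ⨯ U)`. -/
noncomputable def productPresheaf (X : ι → C) (P : Cᵒᵖ ⥤ AddCommGrpCat.{max u v}) :
    Cᵒᵖ ⥤ AddCommGrpCat.{max u v} where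
  obj U := AddCommGrpCat.of (∀ i, P.obj (op (X i ⨯ U.unop)))
  map f := AddCommGrpCat.ofHom
    { toFun := fun s i => P.map (prod.map (𝟙 (X i)) f.unop).op (s i)
      map_zero' := by funext i; exact map_zero _
      map_add' := fun s t => by funext i; exact map_add _ _ _ }
  map_id U := by
    ext s i
    change P.map _ _ = _
    rw [unop_id, prod.map_id_id, op_id, P.map_id]
    rfl
  map_comp f g := by
    ext s i
    change P.map _ _ = P.map _ (P.map _ _)
    rw [← ConcreteCategory.comp_apply, ← P.map_comp, ← op_comp, prod.map_map, Category.comp_id]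
    rfl

/-- Pulling back along the projections `X i ⨯ U ⟶ U`. -/
noncomputable def toProductPresheaf (X : ι → C) (P : Cᵒᵖ ⥤ AddCommGrpCat.{max u v}) :
    P ⟶ productPresheaf X P where
  app U := AddCommGrpCat.ofHom
    { toFun := fun s i => P.map (prod.snd : X i ⨯ U.unop ⟶ U.unop).op s
      map_zero' := by funext i; exact map_zero _
      map_add' := fun s t => by funext i; exact map_add _ _ _ }
  naturality U V f := by
    ext s
    funext i
    change P.map _ (P.map _ _) = P.map _ (P.map _ _)
    rw [← ConcreteCategory.comp_apply, ← ConcreteCategory.comp_apply, ← P.map_comp, ← P.map_comp,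
      ← op_comp, prod.map_snd]
    rfl

/-- A map `V ⟶ U` whose source maps to some `X i` factors through `X i ⨯ U`, and such maps form a
covering sieve, so separatedness applies. -/
theorem mono_toProductPresheaf (hX : J.CoversTop X) (A : Sheaf J AddCommGrpCat.{max u v}) :
    Mono (toProductPresheaf X A.obj) := by
  have : ∀ U, Mono ((toProductPresheaf X A.obj).app U) := by
    intro U
    refine ConcreteCategory.mono_of_injective _ fun s t h => ?_
    refine sec_ext (A := A) (hX U.unop) ?_
    rintro V f ⟨i, ⟨φ⟩⟩
    have e : resSec A (prod.snd : X i ⨯ U.unop ⟶ U.unop) s = resSec A prod.snd t := congrFun h i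
    rw [← prod.lift_snd φ f, resSec_comp, e, resSec_comp]
  exact NatTrans.mono_of_mono_app _

/-- Sheafification is exact and left adjoint to the inclusion, so an injective sheaf is injective as
a presheaf, and the monomorphism into the product presheaf splits. -/
theorem exists_retraction (hX : J.CoversTop X) (I : Sheaf J AddCommGrpCat.{max u v})
    [Injective I] : ∃ r : productPresheaf X I.obj ⟶ I.obj, toProductPresheaf X I.obj ≫ r = 𝟙 _ := by
  have := mono_toProductPresheaf hX I
  have : Injective I.obj :=
    Injective.injective_of_adjoint (sheafificationAdjunction J AddCommGrpCat.{max u v}) I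
  exact ⟨Injective.factorThru (𝟙 _) _, Injective.comp_factorThru _ _⟩

theorem vertex_eqToHom {k : ℕ} (t : Fin k → ι) {a b : Fin k} (h : a = b) {Y : C}
    (hY : X (t a) = Y) : vertex X t a ≫ eqToHom hY = vertex X t b ≫ eqToHom (h ▸ hY) := by
  subst h; rfl

/-- The projection `X_i × X_s ⟶ X_{i s}`, an isomorphism. -/
noncomputable def consMap (X : ι → C) {k : ℕ} (i : ι) (s : Fin k → ι) :
    X i ⨯ cechObj X s ⟶ cechObj X (Fin.cons i s : Fin (k + 1) → ι) :=
  Pi.lift (Fin.cases (prod.fst ≫ eqToHom (by simp))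
    fun a => prod.snd ≫ vertex X s a ≫ eqToHom (by simp))

theorem consMap_vertex_zero {k : ℕ} (i : ι) (s : Fin k → ι) :
    consMap X i s ≫ vertex X (Fin.cons i s : Fin (k + 1) → ι) 0 =
      prod.fst ≫ eqToHom (by simp) :=
  Limits.Pi.lift_π _ _

theorem consMap_vertex_zero_assoc {k : ℕ} (i : ι) (s : Fin k → ι) {Z : C}
    (h : X ((Fin.cons i s : Fin (k + 1) → ι) 0) ⟶ Z) :
    consMap X i s ≫ vertex X (Fin.cons i s : Fin (k + 1) → ι) 0 ≫ h =
      prod.fst ≫ eqToHom (by simp) ≫ h := by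
  rw [← Category.assoc, consMap_vertex_zero, Category.assoc]

theorem consMap_vertex_succ {k : ℕ} (i : ι) (s : Fin k → ι) (a : Fin k) :
    consMap X i s ≫ vertex X (Fin.cons i s : Fin (k + 1) → ι) a.succ =
      prod.snd ≫ vertex X s a ≫ eqToHom (by simp) :=
  Limits.Pi.lift_π _ _

theorem consMap_vertex_succ_assoc {k : ℕ} (i : ι) (s : Fin k → ι) (a : Fin k) {Z : C}
    (h : X ((Fin.cons i s : Fin (k + 1) → ι) a.succ) ⟶ Z) :
    consMap X i s ≫ vertex X (Fin.cons i s : Fin (k + 1) → ι) a.succ ≫ h =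
      prod.snd ≫ vertex X s a ≫ eqToHom (by simp) ≫ h := by
  rw [← Category.assoc, consMap_vertex_succ, Category.assoc, Category.assoc]

/-- Čech cocycles of positive degree of an injective sheaf are coboundaries. -/
theorem exists_cechD_eq_of_injective (hX : J.CoversTop X) (I : Sheaf J AddCommGrpCat.{max u v})
    [Injective I] {k : ℕ} (c : Cochain X I (k + 1)) (hc : cechD c = 0) :
    ∃ b : Cochain X I k, cechD b = c := by
  obtain ⟨r, hr⟩ := exists_retraction hX I
  have hr' : ∀ (U : C) (s : Sec I U), r.app (op U)
      ((fun i => resSec I (prod.snd : X i ⨯ U ⟶ U) s : ∀ i, Sec I (X i ⨯ U))) = s := fun U s =>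
    congrArg (fun φ : I.obj ⟶ I.obj => φ.app (op U) s) hr
  have hnat : ∀ {V U : C} (f : V ⟶ U) (s : ∀ i, Sec I (X i ⨯ U)),
      resSec I f (r.app (op U) s) =
        r.app (op V) (fun i => resSec I (prod.map (𝟙 (X i)) f) (s i) : ∀ i, Sec I (X i ⨯ V)) :=
    fun f s => (congrArg (fun φ => φ.hom s) (r.naturality f.op)).symm
  -- Contracting homotopy: prepend an index `i` to `s`, then use the retraction `r` to eliminate the
  -- dependence on `i`.
  refine ⟨fun s => r.app (op (cechObj X s))
    (fun i => resSec I (consMap X i s) (c (Fin.cons i s)) : ∀ i, Sec I (X i ⨯ cechObj X s)), ?_⟩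
  funext t
  refine Eq.trans ?_ (hr' _ (c t))
  -- The cocycle condition at `(i, t)`: the face forgetting `i` gives `c t`, and the others, shifted
  -- by one place and hence with opposite sign, give the sum.
  have hz : ∀ i, resSec I (prod.snd : X i ⨯ cechObj X t ⟶ _) (c t) =
      ∑ j : Fin (k + 2), (-1 : ℤ) ^ (j : ℕ) • resSec I
        (prod.map (𝟙 (X i)) (face X t j) ≫ consMap X i (t ∘ j.succAbove))
        (c (Fin.cons i (t ∘ j.succAbove))) := by
    intro i
    have h0 : resSec I (consMap X i t) (cechD c (Fin.cons i t)) = 0 := by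
      rw [hc]; exact map_zero _
    rw [resSec_cechD, Fin.sum_univ_succ] at h0
    have e0 : resSec I (consMap X i t ≫ face X (Fin.cons i t : Fin (k + 3) → ι) 0)
        (c ((Fin.cons i t : Fin (k + 3) → ι) ∘ Fin.succAbove 0)) =
        resSec I (prod.snd : X i ⨯ cechObj X t ⟶ _) (c t) := by
      refine resSec_congr c (funext fun a => by simp) _ _ fun a => ?_
      refine (congrArg (· ≫ eqToHom _) ((Category.assoc _ _ _).trans
        (congrArg (consMap X i t ≫ ·) (face_vertex _ _ a)))).trans ?_
      rw [Category.assoc, vertex_eqToHom _ (Fin.zero_succAbove a), consMap_vertex_succ_assoc,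
        eqToHom_trans, eqToHom_refl]
      simp
    have e1 : ∀ j : Fin (k + 2),
        resSec I (consMap X i t ≫ face X (Fin.cons i t : Fin (k + 3) → ι) j.succ)
          (c ((Fin.cons i t : Fin (k + 3) → ι) ∘ Fin.succAbove j.succ)) =
        resSec I (prod.map (𝟙 (X i)) (face X t j) ≫ consMap X i (t ∘ j.succAbove))
          (c (Fin.cons i (t ∘ j.succAbove))) := by
      intro j
      refine resSec_congr c (funext fun a => ?_) _ _ fun a => ?_
      · cases a using Fin.cases <;> simp [Fin.succ_succAbove_succ]
      · refine (congrArg (· ≫ eqToHom _) ((Category.assoc _ _ _).trans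
          (congrArg (consMap X i t ≫ ·) (face_vertex _ _ a)))).trans ?_
        rw [Category.assoc, Category.assoc]
        cases a using Fin.cases with
        | zero =>
          rw [vertex_eqToHom _ (Fin.succ_succAbove_zero j), consMap_vertex_zero_assoc,
            consMap_vertex_zero, eqToHom_trans, prod.map_fst_assoc, Category.id_comp]
        | succ a =>
          rw [vertex_eqToHom _ (Fin.succ_succAbove_succ j a), consMap_vertex_succ_assoc,
            consMap_vertex_succ, eqToHom_trans, prod.map_snd_assoc, face_vertex_assoc]
    rw [e0] at h0
    simp only [e1] at h0
    simp only [Fin.val_zero, pow_zero, one_smul, Fin.val_succ, pow_succ, mul_neg, mul_one, neg_smul,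
      Finset.sum_neg_distrib] at h0
    exact eq_of_sub_eq_zero ((sub_eq_add_neg _ _).trans h0)
  let R : (∀ i, Sec I (X i ⨯ cechObj X t)) →+ Sec I (cechObj X t) := (r.app (op _)).hom
  let w : Fin (k + 2) → ∀ i, Sec I (X i ⨯ cechObj X t) := fun j i =>
    resSec I (prod.map (𝟙 (X i)) (face X t j) ≫ consMap X i (t ∘ j.succAbove))
      (c (Fin.cons i (t ∘ j.succAbove)))
  have h1 : (fun i => resSec I (prod.snd : X i ⨯ cechObj X t ⟶ _) (c t)) =
      ∑ j : Fin (k + 2), (-1 : ℤ) ^ (j : ℕ) • w j := by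
    funext i
    rw [hz, Finset.sum_apply]
    rfl
  refine Eq.trans ?_ (congrArg R h1).symm
  rw [map_sum]
  refine Finset.sum_congr rfl fun j _ => ?_
  rw [map_zsmul]
  refine congrArg _ ((hnat _ _).trans (congrArg R (funext fun i => ?_)))
  exact (resSec_comp _ _ _).symm

end CechInjective

/-! ### Functoriality of the connecting homomorphism -/

section Connecting

variable {C : Type u} [Category.{v} C] {J : GrothendieckTopology C}
  {S S' : ShortComplex (Sheaf J AddCommGrpCat.{max u v})}

theorem connecting_add (hS : S.ShortExact) (k : ℕ) (x y : S.X₃.H k) :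
    connecting hS k (x + y) = connecting hS k x + connecting hS k y :=
  Abelian.Ext.add_comp _ _ _ _

theorem connecting_map_g (hS : S.ShortExact) (k : ℕ) (x : S.X₂.H k) :
    connecting hS k (Sheaf.H.map S.g k x) = 0 := by
  rw [connecting, Sheaf.H.map_apply,
    Abelian.Ext.comp_assoc (a₂₃ := 1) _ _ _ (by lia) (by lia) (by lia), hS.comp_extClass,
    Abelian.Ext.comp_zero]

theorem connecting_naturality (hS : S.ShortExact) (hS' : S'.ShortExact) (φ : S ⟶ S') (k : ℕ)
    (x : S.X₃.H k) : connecting hS' k (Sheaf.H.map φ.τ₃ k x) =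
      Sheaf.H.map φ.τ₁ (k + 1) (connecting hS k x) := by
  rw [connecting, connecting, Sheaf.H.map_apply, Sheaf.H.map_apply,
    Abelian.Ext.comp_assoc (a₂₃ := 1) _ _ _ (by lia) (by lia) (by lia),
    Abelian.Ext.comp_assoc (a₂₃ := 1) _ _ _ (by lia) (by lia) (by lia),
    ShortComplex.ShortExact.extClass_naturality]

/-- A morphism from the first term of a short exact sequence extends to a morphism to the
injective sequence. -/
theorem exists_hom_injectiveSequence (hS : S.ShortExact) {A : Sheaf J AddCommGrpCat.{max u v}}
    (f : S.X₁ ⟶ A) : ∃ φ : S ⟶ injectiveSequence A, φ.τ₁ = f := by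
  have := hS.mono_f
  have := hS.epi_g
  let i : S.X₂ ⟶ Injective.under A := Injective.factorThru (f ≫ Injective.ι A) S.f
  have hi : S.f ≫ i = f ≫ Injective.ι A := Injective.comp_factorThru _ _
  let q : S.X₃ ⟶ cokernel (Injective.ι A) := hS.exact.desc (i ≫ cokernel.π (Injective.ι A)) (by
    rw [← Category.assoc, hi, Category.assoc, cokernel.condition, comp_zero])
  exact ⟨{ τ₁ := f, τ₂ := i, τ₃ := q, comm₁₂ := hi.symm, comm₂₃ := (hS.exact.g_desc _ _).symm }, rfl⟩

end Connecting

/-! ### Čech classes and dimension shifting -/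

section CechClass

variable {C : Type u} [Category.{v} C] [HasFiniteProducts C] {J : GrothendieckTopology C}
  {ι : Type (max u v)} {X : ι → C} {A : Sheaf J AddCommGrpCat.{max u v}}

/-- The morphism to `X_s` with given projections. -/
noncomputable def cechLift {V : C} {k : ℕ} {s : Fin k → ι} (φ : ∀ a, V ⟶ X (s a)) :
    V ⟶ cechObj X s :=
  Pi.lift φ

theorem cechLift_vertex {V : C} {k : ℕ} {s : Fin k → ι} (φ : ∀ a, V ⟶ X (s a)) (a : Fin k) :
    cechLift φ ≫ vertex X s a = φ a :=
  Limits.Pi.lift_π _ _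

/-- The gluing condition for arbitrary maps from `V` to two members of the family, obtained by
pulling back from their product. -/
theorem resSec_eq_of_cechD_eq_zero {c : Cochain X A 0} (hc : cechD c = 0) {V : C} (t : Fin 2 → ι)
    (φ : ∀ a, V ⟶ X (t a)) :
    resSec A (cechLift fun _ => φ 0) (c fun _ => t 0) =
      resSec A (cechLift fun _ => φ 1) (c fun _ => t 1) := by
  have h0 : resSec A (cechLift φ) (cechD c t) = 0 := by
    rw [hc]; exact map_zero _
  rw [resSec_cechD, Fin.sum_univ_two] at h0
  have e : ∀ (j a : Fin 2), j.succAbove (0 : Fin 1) = a →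
      resSec A (cechLift φ ≫ face X t j) (c (t ∘ j.succAbove)) =
      resSec A (cechLift fun _ => φ a) (c fun _ => t a) := by
    rintro j a rfl
    refine resSec_congr c (funext fun b => ?_) _ _ fun b => ?_
    · rw [Subsingleton.elim (α := Fin 1) b 0]; rfl
    · obtain rfl : b = 0 := Subsingleton.elim (α := Fin 1) _ _
      refine (Category.comp_id _).trans ?_
      rw [Category.assoc, face_vertex, cechLift_vertex, cechLift_vertex]
  rw [e 0 1 rfl, e 1 0 rfl] at h0
  simp only [Fin.val_zero, pow_zero, one_smul, Fin.val_one, pow_one, neg_smul] at h0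
  exact (eq_of_sub_eq_zero ((sub_eq_add_neg _ _).trans h0)).symm

/-- Where `V` maps to `X i`, the restriction of `c_i` depends neither on `i` nor on the map; these
values glue along the sieve of the family. -/
theorem exists_global_of_cechD_eq_zero (hX : J.CoversTop X) {c : Cochain X A 0}
    (hc : cechD c = 0) :
    ∃ a : Sec A (⊤_ C), ∀ s, resSec A (terminal.from (cechObj X s)) a = c s := by
  have hind : ∀ {V : C} (i j : ι) (φ : V ⟶ X i) (ψ : V ⟶ X j),
      resSec A (cechLift fun _ => φ) (c fun _ => i) =
        resSec A (cechLift fun _ => ψ) (c fun _ => j) :=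
    fun i j φ ψ => resSec_eq_of_cechD_eq_zero hc ![i, j] fun a => match a with
      | 0 => φ
      | 1 => ψ
  choose i φ using fun (V : C) (f : V ⟶ ⊤_ C) (hf : Sieve.ofObjects X (⊤_ C) f) =>
    (show ∃ i, Nonempty (V ⟶ X i) from hf)
  obtain ⟨a, ha⟩ := exists_glue (A := A) (hX (⊤_ C))
    (fun V f hf => resSec A (cechLift fun _ => (φ V f hf).some) (c fun _ => i V f hf)) (by
      intro W V g f hf hgf
      rw [← resSec_comp]
      refine Eq.trans ?_ (hind (i V f hf) _ (g ≫ (φ V f hf).some) _)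
      congr 2
      exact cechObj_hom_ext fun b => by
        rw [Category.assoc, cechLift_vertex, cechLift_vertex])
  refine ⟨a, fun s => ?_⟩
  rw [ha _ ⟨s 0, ⟨vertex X s 0⟩⟩]
  refine (hind _ (s 0) _ (vertex X s 0)).trans ?_
  refine (resSec_congr c (funext fun b => ?_) _ (𝟙 _) fun b => ?_).trans (resSec_id _)
  · rw [Subsingleton.elim (α := Fin 1) b 0]
  · obtain rfl : b = 0 := Subsingleton.elim (α := Fin 1) _ _
    rw [cechLift_vertex, Category.id_comp]
    exact Category.comp_id _

theorem global_ext (hX : J.CoversTop X) {a b : Sec A (⊤_ C)}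
    (h : ∀ s : Fin 1 → ι, resSec A (terminal.from (cechObj X s)) a =
      resSec A (terminal.from (cechObj X s)) b) : a = b := by
  refine sec_ext (hX _) ?_
  rintro V f ⟨i, ⟨φ⟩⟩
  rw [Subsingleton.elim f ((cechLift fun _ => φ : V ⟶ cechObj X fun _ : Fin 1 => i) ≫
    terminal.from _), resSec_comp, h, resSec_comp]

theorem cechClass_zero (hX : J.CoversTop X) {c : Cochain X A 0} {a : Sec A (⊤_ C)}
    (ha : ∀ s, resSec A (terminal.from (cechObj X s)) a = c s) :
    cechClass X 0 A c = (Sheaf.H.equiv₀ A terminalIsTerminal).symm a := by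
  have h : ∃ a : Sec A (⊤_ C), ∀ s, resSec A (terminal.from (cechObj X s)) a = c s := ⟨a, ha⟩
  rw [cechClass, dif_pos h]
  congr 1
  exact global_ext hX fun s => by rw [h.choose_spec, ha]

/-- The class of a Čech cocycle is natural and additive. -/
structure CechClassNatural (J : GrothendieckTopology C) (X : ι → C) (k : ℕ) : Prop where
  map : ∀ {A B : Sheaf J AddCommGrpCat.{max u v}} (f : A ⟶ B) {c : Cochain X A k}, cechD c = 0 →
    cechClass X k B (mapCochain f c) = Sheaf.H.map f k (cechClass X k A c)
  add : ∀ {A : Sheaf J AddCommGrpCat.{max u v}} {c c' : Cochain X A k}, cechD c = 0 →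
    cechD c' = 0 → cechClass X k A (c + c') = cechClass X k A c + cechClass X k A c'

theorem cechD_mapCochain_g {S : ShortComplex (Sheaf J AddCommGrpCat.{max u v})} {k : ℕ}
    {c : Cochain X S.X₁ (k + 1)} {b : Cochain X S.X₂ k} (hb : cechD b = mapCochain S.f c) :
    cechD (mapCochain S.g b) = 0 := by
  rw [← mapCochain_cechD, hb, ← mapCochain_comp, S.zero, zero_mapCochain]

/-- The dimension shift does not depend on the chosen cochain. -/
theorem CechClassNatural.cechClass_succ {k : ℕ} (H : CechClassNatural J X k)
    {c : Cochain X (injectiveSequence A).X₁ (k + 1)} {b : Cochain X (injectiveSequence A).X₂ k}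
    (hb : cechD b = mapCochain (injectiveSequence A).f c) :
    cechClass X (k + 1) (injectiveSequence A).X₁ c =
      connecting (injectiveSequence_shortExact A) k
        (cechClass X k (injectiveSequence A).X₃ (mapCochain (injectiveSequence A).g b)) := by
  obtain ⟨b', hb', e'⟩ : ∃ b', cechD b' = mapCochain (injectiveSequence A).f c ∧
      cechClass X (k + 1) (injectiveSequence A).X₁ c =
        connecting (injectiveSequence_shortExact A) k
          (cechClass X k (injectiveSequence A).X₃ (mapCochain (injectiveSequence A).g b')) :=
    have h : ∃ b' : Cochain X (injectiveSequence A).X₂ k,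
      cechD b' = mapCochain (injectiveSequence A).f c := ⟨b, hb⟩
    ⟨h.choose, h.choose_spec, dif_pos h⟩
  -- Two choices differ by a cocycle of the middle term, whose class maps to zero under `g` followed
  -- by the connecting homomorphism.
  have hd : cechD (b - b') = 0 := by
    rw [cechD_sub, hb, hb', sub_self]
  have e : mapCochain (injectiveSequence A).g b = mapCochain (injectiveSequence A).g b' +
      mapCochain (injectiveSequence A).g (b - b') := by
    rw [← mapCochain_add, add_sub_cancel]
  rw [e', e, H.add (cechD_mapCochain_g hb')
    (by rw [← mapCochain_cechD, hd, mapCochain_of_zero]), H.map _ hd, connecting_add,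
    connecting_map_g, add_zero]

/-- Injectivity extends `f` to a morphism of sequences, which carries `b` to an admissible choice
for the target. Taking `S` to be an injective sequence gives naturality in the next degree; taking
`f` to be the identity gives compatibility with any short exact sequence. -/
theorem CechClassNatural.cechClass_succ_map {k : ℕ} (H : CechClassNatural J X k)
    {S : ShortComplex (Sheaf J AddCommGrpCat.{max u v})} (hS : S.ShortExact)
    (f : S.X₁ ⟶ (injectiveSequence A).X₁)
    {c : Cochain X S.X₁ (k + 1)} {b : Cochain X S.X₂ k} (hb : cechD b = mapCochain S.f c) :
    cechClass X (k + 1) (injectiveSequence A).X₁ (mapCochain f c) =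
      Sheaf.H.map f (k + 1) (connecting hS k (cechClass X k S.X₃ (mapCochain S.g b))) := by
  obtain ⟨φ, rfl⟩ : ∃ φ : S ⟶ injectiveSequence A, φ.τ₁ = f := exists_hom_injectiveSequence hS f
  have hb' : cechD (mapCochain φ.τ₂ b) =
      mapCochain (injectiveSequence A).f (mapCochain φ.τ₁ c) := by
    rw [← mapCochain_cechD, hb, ← mapCochain_comp, ← mapCochain_comp, φ.comm₁₂]
  rw [H.cechClass_succ hb', ← mapCochain_comp, φ.comm₂₃, mapCochain_comp,
    H.map _ (cechD_mapCochain_g hb), connecting_naturality hS]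

theorem exists_cechD_eq_injectiveSequence (hX : J.CoversTop X) {k : ℕ}
    {c : Cochain X (injectiveSequence A).X₁ (k + 1)} (hc : cechD c = 0) :
    ∃ b : Cochain X (injectiveSequence A).X₂ k,
      cechD b = mapCochain (injectiveSequence A).f c := by
  have : Injective (injectiveSequence A).X₂ := inferInstanceAs (Injective (Injective.under A))
  exact exists_cechD_eq_of_injective hX _ _ (by rw [← mapCochain_cechD, hc, mapCochain_of_zero])

theorem CechClassNatural.succ (hX : J.CoversTop X) {k : ℕ} (H : CechClassNatural J X k) :
    CechClassNatural J X (k + 1) where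
  map {A B} f c hc := by
    obtain ⟨b, hb⟩ := exists_cechD_eq_injectiveSequence (A := A) hX hc
    exact (H.cechClass_succ_map (A := B) (injectiveSequence_shortExact A) f hb).trans
      (congrArg _ (H.cechClass_succ hb).symm)
  add {A c c'} hc hc' := by
    obtain ⟨b, hb⟩ := exists_cechD_eq_injectiveSequence (A := A) hX hc
    obtain ⟨b', hb'⟩ := exists_cechD_eq_injectiveSequence (A := A) hX hc'
    have h : cechD (b + b') =
        mapCochain (injectiveSequence A).f (show Cochain X (injectiveSequence A).X₁ _ from c + c') := by
      rw [cechD_add, hb, hb']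
      exact (mapCochain_add _ _ _).symm
    refine (H.cechClass_succ h).trans ?_
    rw [mapCochain_add, H.add (cechD_mapCochain_g hb) (cechD_mapCochain_g hb'), connecting_add]
    exact congrArg₂ _ (H.cechClass_succ hb).symm (H.cechClass_succ hb').symm

theorem cechClassNatural (hX : J.CoversTop X) (k : ℕ) : CechClassNatural J X k := by
  induction k with
  | zero =>
    refine ⟨fun {A B} f {c} hc => ?_, fun {A c c'} hc hc' => ?_⟩
    · obtain ⟨a, ha⟩ := exists_global_of_cechD_eq_zero hX hc
      rw [cechClass_zero hX ha, Sheaf.H.equiv₀_symm_naturality]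
      exact cechClass_zero hX fun s => (mapSec_resSec f _ a).symm.trans (congrArg _ (ha s))
    · obtain ⟨a, ha⟩ := exists_global_of_cechD_eq_zero hX hc
      obtain ⟨a', ha'⟩ := exists_global_of_cechD_eq_zero hX hc'
      rw [cechClass_zero hX ha, cechClass_zero hX ha', ← map_add]
      exact cechClass_zero hX fun s => by rw [map_add, ha, ha']; rfl
  | succ k H => exact H.succ hX

/-- The canonical map from Čech cocycles to cohomology commutes with connecting homomorphisms. -/
theorem cechClass_eq_connecting (hX : J.CoversTop X)
    {S : ShortComplex (Sheaf J AddCommGrpCat.{max u v})} (hS : S.ShortExact) {k : ℕ}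
    {c : Cochain X S.X₁ (k + 1)} {b : Cochain X S.X₂ k} (hb : cechD b = mapCochain S.f c) :
    cechClass X (k + 1) S.X₁ c =
      connecting hS k (cechClass X k S.X₃ (mapCochain S.g b)) := by
  have h := (cechClassNatural hX k).cechClass_succ_map (A := S.X₁) hS (𝟙 _) hb
  exact h.trans (Sheaf.H.map_id_apply _)

end CechClass

/-! ### The sheaf morphisms attached to a tower -/

namespace TowerData

variable {C : Type u} [Category.{v} C] {J : GrothendieckTopology C}
  (T : TowerData.{v, u, v₁, u₁} J)

theorem aut_add (i : ℕ) {U : C} (x : (T.F i).obj (op U)) (s t : Sec (T.L i) U) :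
    T.aut i x (s + t) = T.aut i x s ≪≫ T.aut i x t := by
  -- Multiplication in `Aut` is composition in the reverse order; commutativity of the sections
  -- compensates for this.
  rw [add_comm]
  exact map_mul (T.act i x) (Multiplicative.ofAdd t) (Multiplicative.ofAdd s)

theorem aut'_add (i : ℕ) {U : C} (x : (T.F i).obj (op U)) (s t : Sec (T.L' i) U) :
    T.aut' i x (s + t) = T.aut' i x s ≪≫ T.aut' i x t := by
  rw [add_comm]
  exact map_mul (T.act' i x) (Multiplicative.ofAdd t) (Multiplicative.ofAdd s)

theorem aut_zero (i : ℕ) {U : C} (x : (T.F i).obj (op U)) : T.aut i x 0 = Iso.refl x :=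
  map_one (T.act i x)

theorem aut_eqToIso (i : ℕ) {U : C} {x y : (T.F i).obj (op U)} (h : x = y) (s : Sec (T.L i) U) :
    T.aut i y s = eqToIso h.symm ≪≫ T.aut i x s ≪≫ eqToIso h := by
  subst h; simp

theorem res_pr (i : ℕ) {V U : C} (f : V ⟶ U) :
    res (T.F (i + 1)) f ⋙ T.pr i V = T.pr i U ⋙ res (T.F i) f :=
  congrArg Cat.Hom.toFunctor ((T.p i).naturality f.op)

theorem pr_res_obj (i : ℕ) {V U : C} (f : V ⟶ U) (x : (T.F (i + 1)).obj (op U)) :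
    (T.pr i V).obj ((res (T.F (i + 1)) f).obj x) = (res (T.F i) f).obj ((T.pr i U).obj x) :=
  Functor.congr_obj (T.res_pr i f) x

theorem pr_res_map (i : ℕ) {V U : C} (f : V ⟶ U) {x y : (T.F (i + 1)).obj (op U)} (φ : x ⟶ y) :
    (T.pr i V).map ((res (T.F (i + 1)) f).map φ) =
      eqToHom (T.pr_res_obj i f x) ≫ (res (T.F i) f).map ((T.pr i U).map φ) ≫
        eqToHom (T.pr_res_obj i f y).symm :=
  Functor.congr_hom (T.res_pr i f) φ

theorem isHomLift_res (i : ℕ) {V U : C} (f : V ⟶ U) {x y : (T.F (i + 1)).obj (op U)} (φ : x ⟶ y)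
    {z w : (T.F i).obj (op U)} (a : z ⟶ w) (h : (T.pr i U).IsHomLift a φ) :
    (T.pr i V).IsHomLift ((res (T.F i) f).map a) ((res (T.F (i + 1)) f).map φ) := by
  obtain ⟨⟩ := h
  exact IsHomLift.of_fac' _ _ _ (T.pr_res_obj i f x) (T.pr_res_obj i f y) (T.pr_res_map i f φ)

namespace IsTorsorTower

variable {T} {n : ℕ} (hT : T.IsTorsorTower n)
include hT

theorem pr_aut {i : ℕ} (hi : 1 ≤ i) (hin : i < n) {U : C} (x : (T.F (i + 1)).obj (op U))
    (s : Sec (T.L (i + 1)) U) : (T.pr i U).mapIso (T.aut (i + 1) x s) = Iso.refl _ :=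
  (hT.aut_range i hi hin x _).1 ⟨s, rfl⟩

theorem aut_pr_res {i : ℕ} (hi : 1 ≤ i) (hin : i < n) {V U : C} (f : V ⟶ U)
    (x : (T.F (i + 2)).obj (op U)) (s : Sec (T.L (i + 1)) U) :
    T.aut (i + 1) ((T.pr (i + 1) V).obj ((res (T.F (i + 2)) f).obj x)) (resSec _ f s) =
      eqToIso (T.pr_res_obj (i + 1) f x) ≪≫
        (res (T.F (i + 1)) f).mapIso (T.aut (i + 1) ((T.pr (i + 1) U).obj x) s) ≪≫
          eqToIso (T.pr_res_obj (i + 1) f x).symm := by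
  rw [hT.aut_res i hi hin, ← T.aut_eqToIso]

theorem exists_inclusion_aux {i : ℕ} (hi : 1 ≤ i) (hin : i + 1 < n) {U : C}
    (x : (T.F (i + 2)).obj (op U)) : ∃ φ : Sec (T.L (i + 2)) U →+ Sec (T.L' (i + 2)) U,
      ∀ s, T.aut' (i + 2) x (φ s) = T.aut (i + 2) x s := by
  have h : ∀ s, ∃ s', T.aut' (i + 2) x s' = T.aut (i + 2) x s := fun s =>
    (hT.aut'_range i hi hin x _).2 (by
      rw [hT.pr_aut (i := i + 1) (by lia) hin, Functor.mapIso_refl])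
  choose φ hφ using h
  exact ⟨AddMonoidHom.mk' φ fun s t => hT.aut'_injective i hi hin x (by
    rw [hφ, T.aut_add, T.aut'_add, hφ, hφ]), hφ⟩

/-- Independence of the object: a local isomorphism `w` commuting with the actions of `L` and `L'`
transports the defining equation from one object to the other. -/
theorem exists_inclusion {i : ℕ} (hi : 1 ≤ i) (hin : i + 1 < n) :
    ∃ α : T.L (i + 2) ⟶ T.L' (i + 2), T.IsInclusion (i + 1) α := by
  choose φ hφ using fun {U : C} (x : (T.F (i + 2)).obj (op U)) =>
    hT.exists_inclusion_aux hi hin x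
  obtain ⟨α, hα⟩ := exists_hom_of_locally (E := fun U => (T.F (i + 2)).obj (op U))
    (fun f x => (res (T.F (i + 2)) f).obj x)
    (hT.locally_nonempty (i + 2) (by lia) (by lia)) φ
    (fun f x s => hT.aut'_injective i hi hin _ (by
      rw [hφ, ← hT.aut'_res i hi hin, hφ, ← hT.aut_res (i + 1) (by lia) hin]))
    (fun {U} x y => by
      obtain ⟨S, hS, H⟩ := hT.locally_isomorphic (i + 1) (by lia) hin x y
      refine ⟨S, hS, fun V f hf => ?_⟩
      obtain ⟨w, -, h1, h2⟩ := H f hf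
      ext s
      refine hT.aut'_injective i hi hin ((res (T.F (i + 2)) f).obj y) (Iso.ext ?_)
      rw [← cancel_epi w.hom, ← (h2 (by lia)).1, hφ, hφ]
      exact h1 s)
  exact ⟨α, fun {U} x s => by rw [hα, hφ]⟩

theorem exists_projection_aux {i : ℕ} (hi : 1 ≤ i) (hin : i + 1 < n) {U : C}
    (x : (T.F (i + 2)).obj (op U)) : ∃ φ : Sec (T.L' (i + 2)) U →+ Sec (T.L (i + 1)) U,
      ∀ s, T.aut (i + 1) ((T.pr (i + 1) U).obj x) (φ s) =
        (T.pr (i + 1) U).mapIso (T.aut' (i + 2) x s) := by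
  have h : ∀ s, ∃ s', T.aut (i + 1) ((T.pr (i + 1) U).obj x) s' =
      (T.pr (i + 1) U).mapIso (T.aut' (i + 2) x s) := fun s =>
    (hT.aut_range i hi (by lia) _ _).2 ((hT.aut'_range i hi hin x _).1 ⟨s, rfl⟩)
  choose φ hφ using h
  exact ⟨AddMonoidHom.mk' φ fun s t => hT.aut_injective i hi (by lia) _ (by
    rw [hφ, T.aut_add, T.aut'_add, hφ, hφ, Functor.mapIso_trans]), hφ⟩

/-- Independence of the object now uses that `w` commutes with `L'` upstairs and that its projection
commutes with `L` one level below. -/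
theorem exists_projection {i : ℕ} (hi : 1 ≤ i) (hin : i + 1 < n) :
    ∃ β : T.L' (i + 2) ⟶ T.L (i + 1), T.IsProjection (i + 1) β := by
  choose φ hφ using fun {U : C} (x : (T.F (i + 2)).obj (op U)) =>
    hT.exists_projection_aux hi hin x
  obtain ⟨β, hβ⟩ := exists_hom_of_locally (E := fun U => (T.F (i + 2)).obj (op U))
    (fun f x => (res (T.F (i + 2)) f).obj x)
    (hT.locally_nonempty (i + 2) (by lia) (by lia)) φ
    (fun f x s => hT.aut_injective i hi (by lia) _ (by
      rw [hφ, hT.aut_pr_res hi (by lia), hφ, ← hT.aut'_res i hi hin]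
      exact Iso.ext (T.pr_res_map (i + 1) f _)))
    (fun {U} x y => by
      obtain ⟨S, hS, H⟩ := hT.locally_isomorphic (i + 1) (by lia) hin x y
      refine ⟨S, hS, fun V f hf => ?_⟩
      obtain ⟨w, -, -, h⟩ := H f hf
      obtain ⟨h1, h2⟩ := h (by lia)
      ext s
      refine hT.aut_injective i hi (by lia)
        ((T.pr (i + 1) V).obj ((res (T.F (i + 2)) f).obj y)) (Iso.ext ?_)
      rw [← cancel_epi ((T.pr (i + 1) V).mapIso w).hom, ← h2, hφ, hφ]
      have := congrArg (T.pr (i + 1) V).map (h1 s)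
      simpa using this)
  exact ⟨β, fun {U} x s => by rw [hβ, hφ]⟩

theorem inclusion_unique {i : ℕ} (hi : 1 ≤ i) (hin : i + 1 < n) {α α' : T.L (i + 2) ⟶ T.L' (i + 2)}
    (hα : T.IsInclusion (i + 1) α) (hα' : T.IsInclusion (i + 1) α') : α = α' := by
  refine hom_ext_mapSec fun U s => ?_
  obtain ⟨S, hS, H⟩ := hT.locally_nonempty (i + 2) (by lia) (by lia) U
  refine sec_ext hS fun V f hf => ?_
  obtain ⟨x⟩ := H f hf
  rw [← mapSec_resSec, ← mapSec_resSec]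
  exact hT.aut'_injective i hi hin x ((hα x _).trans (hα' x _).symm)

theorem projection_unique {i : ℕ} (hi : 1 ≤ i) (hin : i + 1 < n)
    {β β' : T.L' (i + 2) ⟶ T.L (i + 1)}
    (hβ : T.IsProjection (i + 1) β) (hβ' : T.IsProjection (i + 1) β') : β = β' := by
  refine hom_ext_mapSec fun U s => ?_
  obtain ⟨S, hS, H⟩ := hT.locally_nonempty (i + 2) (by lia) (by lia) U
  refine sec_ext hS fun V f hf => ?_
  obtain ⟨x⟩ := H f hf
  rw [← mapSec_resSec, ← mapSec_resSec]
  exact hT.aut_injective i hi (by lia) _ ((hβ x _).trans (hβ' x _).symm)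

/-! ### Exactness of the sequence -/

section Exact

variable {i : ℕ} (hi : 1 ≤ i) (hin : i + 1 < n) {α : T.L (i + 2) ⟶ T.L' (i + 2)}
  (hα : T.IsInclusion (i + 1) α) {β : T.L' (i + 2) ⟶ T.L (i + 1)} (hβ : T.IsProjection (i + 1) β)
include hin hα

theorem mapSec_inclusion_injective (U : C) : Function.Injective (mapSec α U) := by
  intro s t h
  obtain ⟨S, hS, H⟩ := hT.locally_nonempty (i + 2) (by lia) (by lia) U
  refine sec_ext hS fun V f hf => ?_
  obtain ⟨x⟩ := H f hf
  refine hT.aut_injective (i + 1) (by lia) hin x ?_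
  rw [← hα x, ← hα x, mapSec_resSec, mapSec_resSec, h]

include hi hβ

theorem inclusion_comp_projection : α ≫ β = 0 := by
  refine hom_ext_mapSec fun U s => ?_
  rw [mapSec_comp, mapSec_zero]
  obtain ⟨S, hS, H⟩ := hT.locally_nonempty (i + 2) (by lia) (by lia) U
  refine sec_ext hS fun V f hf => ?_
  obtain ⟨x⟩ := H f hf
  refine hT.aut_injective i hi (by lia) ((T.pr (i + 1) V).obj x) ?_
  rw [map_zero, T.aut_zero, ← mapSec_resSec, ← mapSec_resSec, hβ x, hα x,
    hT.pr_aut (by lia) hin]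

/-- On a local object, `s` acts over the identity and so comes from `L`; injectivity of `α` makes
the local preimages compatible. Thus exactness in the middle holds on sections, not just locally. -/
theorem exists_of_mapSec_projection_eq_zero {U : C} (s : Sec (T.L' (i + 2)) U)
    (hs : mapSec β U s = 0) : ∃ t, mapSec α U t = s := by
  obtain ⟨S, hS, H⟩ := hT.locally_nonempty (i + 2) (by lia) (by lia) U
  have h : ∀ ⦃V : C⦄ (f : V ⟶ U), S f → ∃ t, mapSec α V t = resSec _ f s := by
    intro V f hf
    obtain ⟨x⟩ := H f hf
    obtain ⟨t, ht⟩ := (hT.aut_range (i + 1) (by lia) hin x (T.aut' (i + 2) x (resSec _ f s))).2 (by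
      rw [← hβ x, mapSec_resSec, hs, map_zero, T.aut_zero])
    exact ⟨t, hT.aut'_injective i hi hin x ((hα x t).trans ht)⟩
  choose t ht using h
  obtain ⟨t', ht'⟩ := exists_glue hS t fun W V g f hf hgf =>
    hT.mapSec_inclusion_injective hin hα W (by rw [mapSec_resSec, ht, ht, resSec_comp])
  exact ⟨t', sec_ext hS fun V f hf => by rw [← mapSec_resSec, ht' f hf, ht]⟩

omit hα hβ

/-- Automorphisms which project to an identity have invertible lifts. -/
theorem exists_isIso_lift {U : C} (x : (T.F (i + 2)).obj (op U))
    (a : (T.pr (i + 1) U).obj x ≅ (T.pr (i + 1) U).obj x)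
    (ha : (T.pr i U).mapIso a = Iso.refl _) :
    ∃ (x' : (T.F (i + 2)).obj (op U)) (φ : x' ≅ x), (T.pr (i + 1) U).IsHomLift a.hom φ.hom := by
  have hlift : ∀ b : (T.pr (i + 1) U).obj x ⟶ (T.pr (i + 1) U).obj x, (T.pr i U).map b = 𝟙 _ →
      ∀ y, (T.pr (i + 1) U).obj y = (T.pr (i + 1) U).obj x →
      ∃ (x' : (T.F (i + 2)).obj (op U)) (φ : x' ⟶ y), (T.pr (i + 1) U).IsHomLift b φ := by
    intro b hb y hy
    obtain ⟨x', φ, h⟩ := hT.cartesian_lift i hi hin b (hb ▸ IsHomLift.map _ b) y hy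
    exact ⟨x', φ, h.toIsHomLift⟩
  have hiso : ∀ {y z : (T.F (i + 2)).obj (op U)} (φ : y ⟶ z),
      (T.pr (i + 1) U).IsHomLift (𝟙 ((T.pr (i + 1) U).obj x)) φ → IsIso φ := by
    intro y z φ h
    refine hT.isIso_of_isHomLift_id (i + 1) (by lia) hin φ ?_
    rwa [IsHomLift.domain_eq (T.pr (i + 1) U) (𝟙 ((T.pr (i + 1) U).obj x)) φ]
  have ha1 : (T.pr i U).map a.hom = 𝟙 _ := congrArg Iso.hom ha
  have ha2 : (T.pr i U).map a.inv = 𝟙 _ := congrArg Iso.inv ha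
  -- Lift `a`, then its inverse, then `a` again. Consecutive composites lie over identities and are
  -- therefore invertible, so `φ₂` is both mono and split epi, hence invertible, and so is `φ₁`.
  obtain ⟨x₁, φ₁, h₁⟩ := hlift a.hom ha1 x rfl
  obtain ⟨x₂, φ₂, h₂⟩ := hlift a.inv ha2 x₁ (IsHomLift.domain_eq _ a.hom φ₁)
  obtain ⟨x₃, φ₃, h₃⟩ := hlift a.hom ha1 x₂ (IsHomLift.domain_eq _ a.inv φ₂)
  have i₁ : IsIso (φ₂ ≫ φ₁) := hiso _ (a.inv_hom_id ▸ IsHomLift.comp _ a.inv a.hom φ₂ φ₁)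
  have i₂ : IsIso (φ₃ ≫ φ₂) := hiso _ (a.hom_inv_id ▸ IsHomLift.comp _ a.hom a.inv φ₃ φ₂)
  have : Mono φ₂ := mono_of_mono φ₂ φ₁
  have : IsSplitEpi φ₂ := IsSplitEpi.mk' ⟨inv (φ₃ ≫ φ₂) ≫ φ₃, by simp⟩
  have : IsIso φ₂ := isIso_of_mono_of_isSplitEpi φ₂
  have : IsIso φ₁ := IsIso.of_isIso_comp_left φ₂ φ₁
  exact ⟨x₁, asIso φ₁, h₁⟩

include hβ

/-- The lift `φ : x' ≅ x` of `s` need not be an automorphism, but `x'` and `x` have the same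
projection. A local isomorphism `w : x' ≅ x` therefore lies over the identity, and `w⁻¹` followed by
`φ` is an automorphism of `x` lifting `s`. -/
theorem projection_locallySurjective_of_obj {U : C} (x : (T.F (i + 2)).obj (op U))
    (s : Sec (T.L (i + 1)) U) : ∃ S ∈ J U, ∀ ⦃V : C⦄ (f : V ⟶ U), S f →
      ∃ t, mapSec β V t = resSec _ f s := by
  obtain ⟨x', φ, hφ⟩ := hT.exists_isIso_lift hi hin x (T.aut (i + 1) _ s)
    (hT.pr_aut hi (by lia) _ s)
  obtain ⟨S, hS, H⟩ := hT.locally_isomorphic (i + 1) (by lia) hin x' x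
  refine ⟨S, hS, fun V f hf => ?_⟩
  obtain ⟨w, hw, -⟩ := H f hf
  have hx' : (T.pr (i + 1) U).obj x' = (T.pr (i + 1) U).obj x :=
    IsHomLift.domain_eq _ (T.aut (i + 1) _ s).hom φ.hom
  have hw : (T.pr (i + 1) V).IsHomLift (𝟙 _) w.hom :=
    hw.1 (by rw [T.pr_res_obj, T.pr_res_obj, hx'])
  have hw' := IsHomLift.lift_id_inv (T.pr (i + 1) V)
    ((T.pr (i + 1) V).obj ((res (T.F (i + 2)) f).obj x')) w
  have hres := T.isHomLift_res (i + 1) f φ.hom _ hφ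
  have hlift := IsHomLift.comp_lift_id_left' (T.pr (i + 1) V)
    ((T.pr (i + 1) V).obj ((res (T.F (i + 2)) f).obj x')) w.inv
    ((res (T.F (i + 1)) f).map (T.aut (i + 1) ((T.pr (i + 1) U).obj x) s).hom)
    ((res (T.F (i + 2)) f).map φ.hom)
  have hψ : (T.pr (i + 1) V).mapIso (w.symm ≪≫ (res (T.F (i + 2)) f).mapIso φ) =
      T.aut (i + 1) _ (resSec _ f s) := by
    rw [hT.aut_pr_res hi (by lia)]
    exact Iso.ext (IsHomLift.fac' (T.pr (i + 1) V)
      ((res (T.F (i + 1)) f).map (T.aut (i + 1) ((T.pr (i + 1) U).obj x) s).hom)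
      (w.inv ≫ (res (T.F (i + 2)) f).map φ.hom))
  obtain ⟨t, ht⟩ := (hT.aut'_range i hi hin _
    (w.symm ≪≫ (res (T.F (i + 2)) f).mapIso φ)).2 (by
      rw [hψ, hT.pr_aut hi (by lia)])
  refine ⟨t, hT.aut_injective i hi (by lia)
    ((T.pr (i + 1) V).obj ((res (T.F (i + 2)) f).obj x)) ?_⟩
  rw [hβ, ht, hψ]

theorem epi_projection : Epi β := by
  refine (Sheaf.isLocallySurjective_iff_epi' AddCommGrpCat.{max u v} β).1 ⟨fun {U} s => ?_⟩
  obtain ⟨S, hS, H⟩ := hT.locally_nonempty (i + 2) (by lia) (by lia) U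
  refine J.transitive hS _ fun V f hf => ?_
  obtain ⟨x⟩ := H f hf
  obtain ⟨R, hR, h⟩ := hT.projection_locallySurjective_of_obj hi hin hβ x (resSec _ f s)
  refine J.superset_covering (fun W g hg => ?_) hR
  obtain ⟨t, ht⟩ := h g hg
  exact ⟨t, ht.trans (resSec_comp g f s).symm⟩

include hα

theorem shortExact (w : α ≫ β = 0) : (ShortComplex.mk α β w).ShortExact := by
  have hmono : Mono α := Sheaf.mono_of_injective _ fun U =>
    hT.mapSec_inclusion_injective hin hα U.unop
  have hepi := hT.epi_projection hi hin hβ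
  refine ShortComplex.ShortExact.mk' ?_ hmono hepi
  -- A morphism killed by `β` factors through `α` section by section; injectivity of `α` makes the
  -- factors additive and natural.
  refine ShortComplex.exact_of_f_is_kernel _ (KernelFork.IsLimit.ofι' _ _ fun {W} k hk => ?_)
  have hk' : ∀ U s, ∃ t, mapSec α U t = mapSec k U s := fun U s =>
    hT.exists_of_mapSec_projection_eq_zero hi hin hα hβ _ (by rw [← mapSec_comp, hk]; rfl)
  choose t ht using hk'
  have hinj := hT.mapSec_inclusion_injective hin hα
  have := exists_hom (A := W) (B := T.L (i + 2))
    (fun U => AddMonoidHom.mk' (t U) fun a b => hinj U (by rw [map_add, ht, ht, ht, map_add]))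
    (fun V U f s => hinj V (by
      change mapSec α V (t V _) = mapSec α V (resSec _ f (t U s))
      rw [ht, mapSec_resSec, mapSec_resSec, ht]))
  exact ⟨this.choose, hom_ext_mapSec fun U s => by
    rw [mapSec_comp, this.choose_spec]
    exact ht U s⟩

end Exact

end IsTorsorTower

end TowerData

/-! ### The cocycle conditions and the lifting cochain -/

namespace TowerData

variable {C : Type u} [Category.{v} C] {J : GrothendieckTopology C}
  {T : TowerData.{v, u, v₁, u₁} J} [HasFiniteProducts C] {ι : Type (max u v)} {X : ι → C}

theorem res_mapIso_pullIso (G : Cᵒᵖ ⥤ Cat.{v₁, u₁}) {Xi Xj W V : C} {xi : G.obj (op Xi)}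
    {xj : G.obj (op Xj)}
    (g : (res G (prod.snd : Xi ⨯ Xj ⟶ Xj)).obj xj ≅ (res G (prod.fst : Xi ⨯ Xj ⟶ Xi)).obj xi)
    (f : V ⟶ W) (a : W ⟶ Xi) (b : W ⟶ Xj) {a' : V ⟶ Xi} {b' : V ⟶ Xj} (ha : f ≫ a = a')
    (hb : f ≫ b = b') :
    (res G f).mapIso (pullIso G g a b) =
      eqToIso (by rw [← res_comp_obj, hb]) ≪≫ pullIso G g a' b' ≪≫
        eqToIso (by rw [← res_comp_obj, ha]) := by
  subst ha hb
  have h : res G (prod.lift (f ≫ a) (f ≫ b)) = res G (prod.lift a b) ⋙ res G f := by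
    rw [← prod.comp_lift, res, op_comp, G.map_comp]
    rfl
  ext
  have := Functor.congr_hom h g.hom
  simp [pullIso, this, eqToHom_map]

/-- Over a fourfold product every term is a word in the restricted `g_{ab}`; once all of them act on
the same object, the words for `s 0 + s 2` and `s 3 + s 1` cancel to the same one. -/
theorem IsGerbeCocycle.cechD_eq_zero {n : ℕ} (hT : T.IsTorsorTower n) (hn : 2 ≤ n)
    {c : Cochain X (T.L 2) 2} (hc : T.IsGerbeCocycle X c) : cechD c = 0 := by
  obtain ⟨x, g, h⟩ := hc
  funext t
  let y : ∀ a : Fin 4, (T.F 2).obj (op (cechObj X t)) := fun a =>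
    (res (T.F 2) (vertex X t a)).obj (x (t a))
  let G : ∀ a b : Fin 4, y b ≅ y a := fun a b =>
    pullIso (T.F 2) (g (t a) (t b)) (vertex X t a) (vertex X t b)
  let s : Fin 4 → Sec (T.L 2) (cechObj X t) := fun j =>
    resSec _ (face X t j) (c (t ∘ j.succAbove))
  have key : ∀ j a b d : Fin 4, j.succAbove 0 = a → j.succAbove 1 = b → j.succAbove 2 = d →
      T.aut 2 (y d) (s j) = G b d ≪≫ G a b ≪≫ (G a d).symm := by
    rintro j _ _ _ rfl rfl rfl
    have e := congrArg (res (T.F 2) (face X t j)).mapIso (h (t ∘ j.succAbove))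
    have ey : (res (T.F 2) (face X t j)).obj
        ((res (T.F 2) (vertex X (t ∘ j.succAbove) 2)).obj (x ((t ∘ j.succAbove) 2))) =
        y (j.succAbove 2) := by
      rw [← res_comp_obj, face_vertex]
      rfl
    rw [hT.aut_res 1 le_rfl (by lia)] at e
    rw [T.aut_eqToIso 2 ey]
    refine (congrArg (fun φ => eqToIso ey.symm ≪≫ φ ≪≫ eqToIso ey) e).trans ?_
    rw [Functor.mapIso_trans, Functor.mapIso_trans, Functor.mapIso_symm,
      res_mapIso_pullIso _ _ _ _ _ (face_vertex t j 1) (face_vertex t j 2),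
      res_mapIso_pullIso _ _ _ _ _ (face_vertex t j 0) (face_vertex t j 1),
      res_mapIso_pullIso _ _ _ _ _ (face_vertex t j 0) (face_vertex t j 2)]
    ext
    simp
    rfl
  -- The term forgetting the last index is given on `y 2`, the other three on `y 3`. Naturality of
  -- the band moves it along `G 2 3`, since every arrow of `F_2(U)` lies over an identity.
  have hnat : T.aut 2 (y 3) (s 3) ≪≫ G 2 3 = G 2 3 ≪≫ T.aut 2 (y 2) (s 3) := by
    refine Iso.ext (hT.aut_natural 1 le_rfl (by lia) (G 2 3).hom ?_ (s 3))
    have := hT.base_obj (cechObj X t)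
    obtain ⟨hu⟩ := this
    have hs := hT.base_hom (cechObj X t)
    exact IsHomLift.of_fac' _ _ _ rfl (Subsingleton.elim _ _) (Subsingleton.elim _ _)
  have k0 := key 0 1 2 3 rfl rfl rfl
  have k1 := key 1 0 2 3 rfl rfl rfl
  have k2 := key 2 0 1 3 rfl rfl rfl
  have k3 := key 3 0 1 2 rfl rfl rfl
  have k3' : T.aut 2 (y 3) (s 3) = G 2 3 ≪≫ (G 1 2 ≪≫ G 0 1 ≪≫ (G 0 2).symm) ≪≫ (G 2 3).symm := by
    rw [← k3]
    ext
    have := congrArg Iso.hom hnat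
    simp only [Iso.trans_hom] at this
    simp [← reassoc_of% this]
  have hsum : s 0 + s 2 = s 3 + s 1 := by
    refine hT.aut_injective 1 le_rfl (by lia) (y 3) ?_
    rw [T.aut_add, T.aut_add, k0, k1, k2, k3']
    ext
    simp
  change ∑ j : Fin 4, (-1 : ℤ) ^ (j : ℕ) • s j = 0
  rw [Fin.sum_univ_four]
  have : s 0 + s 2 - (s 3 + s 1) = 0 := sub_eq_zero.2 hsum
  rw [← this]
  simp [pow_succ]
  abel

theorem mapCochain_inclusion_eq {n i : ℕ} (hT : T.IsTorsorTower n) (hi : 1 ≤ i)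
    (hin : i + 1 < n) {α : T.L (i + 2) ⟶ T.L' (i + 2)} (hα : T.IsInclusion (i + 1) α)
    {c : Cochain X (T.L (i + 2)) (i + 2)} {cs : Cochain X (T.L' (i + 2)) (i + 1)}
    (x : ∀ t : Fin (i + 3) → ι, (T.F (i + 2)).obj (op (cechObj X t)))
    (h : ∀ t : Fin (i + 3) → ι, T.aut (i + 2) (x t) (c t) = T.aut' (i + 2) (x t) (cechD cs t)) :
    mapCochain α c = cechD cs :=
  funext fun t => hT.aut'_injective i hi hin (x t) ((hα (x t) (c t)).trans (h t))

theorem cechD_eq_zero_of_mapCochain_inclusion_eq {n i : ℕ} (hT : T.IsTorsorTower n)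
    (hin : i + 1 < n) {α : T.L (i + 2) ⟶ T.L' (i + 2)} (hα : T.IsInclusion (i + 1) α)
    {k : ℕ} {c : Cochain X (T.L (i + 2)) (k + 1)} {b : Cochain X (T.L' (i + 2)) k}
    (h : mapCochain α c = cechD b) : cechD c = 0 := by
  funext t
  refine hT.mapSec_inclusion_injective hin hα _ ?_
  have := congrFun (mapCochain_cechD α c) t
  rw [h, cechD_cechD] at this
  exact this.trans (map_zero _).symm

/-- Restriction along the projections which forget the first index is injective. -/
theorem resSec_face_zero_injective {A : Sheaf J AddCommGrpCat.{max u v}} {k : ℕ}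
    (t : Fin (k + 2) → ι) (h : t 0 = t 1) : Function.Injective (resSec A (face X t 0)) := by
  -- Repeating the first coordinate is a section of the projection, because `t 0 = t 1`.
  let r : cechObj X (t ∘ Fin.succAbove 0) ⟶ cechObj X t := cechLift (Fin.cases
    (vertex X (t ∘ Fin.succAbove 0) 0 ≫ eqToHom (congrArg X h.symm))
    fun a => vertex X (t ∘ Fin.succAbove 0) a)
  have hr : r ≫ face X t 0 = 𝟙 _ := cechObj_hom_ext fun a => by
    rw [Category.assoc, face_vertex, Category.id_comp]
    exact cechLift_vertex _ a.succ
  intro s s' e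
  rw [← resSec_id s, ← hr, resSec_comp, e, ← resSec_comp, hr, resSec_id]

/-- The lifting condition only compares `β cs` with `c` after restriction to products with one more
factor, where the chosen objects live. For a tuple with its first index repeated this restriction is
injective, so the equality descends. -/
theorem IsNextCocycle.exists_cochain {n i : ℕ} (hT : T.IsTorsorTower n) (hi : 1 ≤ i)
    (hin : i + 1 < n) {α : T.L (i + 2) ⟶ T.L' (i + 2)} (hα : T.IsInclusion (i + 1) α)
    {β : T.L' (i + 2) ⟶ T.L (i + 1)} (hβ : T.IsProjection (i + 1) β)
    {c : Cochain X (T.L (i + 1)) (i + 1)} {c' : Cochain X (T.L (i + 2)) (i + 2)}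
    (h : T.IsNextCocycle X (i + 1) c c') :
    ∃ b : Cochain X (T.L' (i + 2)) (i + 1), mapCochain β b = c ∧ mapCochain α c' = cechD b := by
  obtain ⟨x, cs, h1, h2⟩ := h
  refine ⟨cs, funext fun s => ?_, mapCochain_inclusion_eq hT hi hin hα x h2⟩
  obtain ⟨t, ht, rfl⟩ : ∃ t : Fin (i + 3) → ι, t 0 = t 1 ∧ t ∘ Fin.succAbove 0 = s :=
    ⟨Fin.cons (s 0) s, rfl, funext fun a => by simp⟩
  refine resSec_face_zero_injective t ht
    (hT.aut_injective i hi (by lia) ((T.pr (i + 1) _).obj (x t)) ?_)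
  refine Eq.trans ?_ (h1 t 0)
  rw [mapCochain, ← mapSec_resSec]
  exact hβ (x t) _

/-- No induction is needed: above degree 2, `α c_l` is a coboundary whether or not `c_{l-1}` is a
cocycle. -/
theorem IsClassifyingFamily.cechD_eq_zero {n : ℕ} (hT : T.IsTorsorTower n)
    {c : ∀ l, Cochain X (T.L l) l} (hc : T.IsClassifyingFamily X n c) :
    ∀ l, 2 ≤ l → l ≤ n → cechD (c l) = 0
  | 2, _, hn => hc.1.cechD_eq_zero hT hn
  | i + 3, _, hn => by
    obtain ⟨α, hα⟩ := hT.exists_inclusion (i := i + 1) (by lia) (by lia)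
    obtain ⟨x, cs, -, h⟩ := hc.2 (i + 2) (by lia) (by lia)
    exact cechD_eq_zero_of_mapCochain_inclusion_eq hT (by lia) hα
      (mapCochain_inclusion_eq hT (by lia) (by lia) hα x h)

end TowerData

end TorsorTowers

/-! ### The Dolbeault operator on the classifying classes -/

theorem proposition9 {C : Type u} [Category.{v} C] [HasFiniteProducts C]
    (J : GrothendieckTopology C) (n : ℕ) (T : TorsorTowers.TowerData.{v, u, v₁, u₁} J)
    (hT : T.IsTorsorTower n) {ι : Type (max u v)} (X : ι → C) (hX : J.CoversTop X)
    (c : ∀ l, TorsorTowers.Cochain X (T.L l) l) (hc : T.IsClassifyingFamily X n c)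
    (l : ℕ) (hl : 2 ≤ l) (hln : l < n) :
    (∃! q : (T.L (l + 1) ⟶ T.L' (l + 1)) × (T.L' (l + 1) ⟶ T.L l),
      T.IsInclusion l q.1 ∧ T.IsProjection l q.2) ∧
    ∀ (α : T.L (l + 1) ⟶ T.L' (l + 1)) (β : T.L' (l + 1) ⟶ T.L l),
      T.IsInclusion l α → T.IsProjection l β →
      ∃ (w : α ≫ β = 0) (hS : (ShortComplex.mk α β w).ShortExact),
        TorsorTowers.cechD (c l) = 0 ∧ TorsorTowers.cechD (c (l + 1)) = 0 ∧
        (∃ b : TorsorTowers.Cochain X (T.L' (l + 1)) l,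
          TorsorTowers.mapCochain β b = c l ∧
          TorsorTowers.mapCochain α (c (l + 1)) = TorsorTowers.cechD b) ∧
        TorsorTowers.cechClass X (l + 1) (T.L (l + 1)) (c (l + 1)) =
          TorsorTowers.connecting hS l (TorsorTowers.cechClass X l (T.L l) (c l)) := by
  obtain ⟨i, rfl⟩ : ∃ i, l = i + 1 := ⟨l - 1, by lia⟩
  have hi : 1 ≤ i := by lia
  refine ⟨?_, fun α β hα hβ => ?_⟩
  · obtain ⟨α, hα⟩ := hT.exists_inclusion hi hln
    obtain ⟨β, hβ⟩ := hT.exists_projection hi hln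
    exact ⟨(α, β), ⟨hα, hβ⟩, fun q hq => Prod.ext (hT.inclusion_unique hi hln hq.1 hα)
      (hT.projection_unique hi hln hq.2 hβ)⟩
  · have w := hT.inclusion_comp_projection hi hln hα hβ
    have hS := hT.shortExact hi hln hα hβ w
    obtain ⟨b, hb, hb'⟩ := (hc.2 (i + 1) hl hln).exists_cochain hT hi hln hα hβ
    refine ⟨w, hS, hc.cechD_eq_zero hT _ hl hln.le, hc.cechD_eq_zero hT _ (by lia) hln,
      ⟨b, hb, hb'⟩, ?_⟩
    -- With `c_l` written as `β b`, the pair `c_{l+1}`, `b` is exactly a computation of the Čech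
    -- connecting map.
    rw [← hb]
    exact TorsorTowers.cechClass_eq_connecting hX hS hb'.symm
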